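/- Let $n\ge 2$ be an even integer and let $V:\mathbb{R}\to[0,\infty)$ be continuous (in particular, $V$ may be any Hölder function) with $V(\lambda)\ge 2(1+\delta)\log(1+|\lambda|)$ for all $\lambda\in\mathbb{R}$ and some $\delta>0$. Consider the $\beta=1$ ensemble, that is, random $(\lambda_1,\dots,\lambda_n)\in\mathbb{R}^n$ (the eigenvalues) with joint density $$p_n(\lambda_1,\dots,\lambda_n)=Q_n^{-1}\exp\Big\{-\frac n2\sum_{j=1}^nV(\lambda_j)\Big\}\prod_{1\le j<k\le n}|\lambda_j-\lambda_k| ,$$ where $Q_n$ is the normalizing constant. Let $p_l$ $(l=0,\dots,n-1)$ be the orthonormal polynomials with positive leading coefficients of the weight $w_n=e^{-nV}$, and let $\psi_l=w_n^{1/2}p_l$. Put $\epsilon(\lambda)=\frac12\operatorname{sign}\lambda$ (with $\epsilon(0)=0$), $(\epsilon f)(\lambda)=\int\epsilon(\lambda-\mu)f(\mu)\,d\mu$, $M=\{M_{j,l}\}_{j,l=0}^{n-1}$ with $M_{j,l}=n\int\psi_j(\lambda)\,(\epsilon\psi_l)(\lambda)\,d\lambda$, and $$S_n(\lambda,\mu)=-\sum_{i,j=0}^{n-1}\psi_i(\lambda)(M^{-1})_{i,j}\,n(\epsilon\psi_j)(\mu),\qquad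 S_nd(\lambda,\mu)=-\frac{\partial}{\partial\mu}S_n(\lambda,\mu),\qquad IS_n(\lambda,\mu)=\int\epsilon(\lambda-\lambda')S_n(\lambda',\mu)\,d\lambda',$$ and let $\widehat K_n$ be the Tracy–Widom matrix kernel $$\widehat K_n(\lambda,\mu)=\begin{pmatrix}S_n(\lambda,\mu)&S_nd(\lambda,\mu)\\ IS_n(\lambda,\mu)-\epsilon(\lambda-\mu)&S_n(\mu,\lambda)\end{pmatrix}.$$ Let $\varphi:\mathbb{R}\to\mathbb{R}$ be a measurable function with $\mathbf{E}\{\varphi(\lambda_j)^2\}<\infty$ for $j=1,\dots,n$, and let $N_n[\varphi]=\varphi(\lambda_1)+\dots+\varphi(\lambda_n)$. Then all these objects are well defined ($p_n$ is a probability density, $M$ is invertible, $S_n(\lambda,\mu)$ is differentiable in $\mu$ and integrable in $\lambda$, and the integrand below is integrable over $\mathbb{R}^2$), and $$\mathbf{Var}\{N_n[\varphi]\}=\frac14\int\!\!\int(\varphi(\mu_1)-\varphi(\mu_2))^2\,\operatorname{tr}\big(\widehat K_n(\mu_1,\mu_2)\widehat K_n(\mu_2,\mu_1)\big)\,d\mu_1\,d\mu_2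 .$$ -/

import Mathlib

open MeasureTheory ProbabilityTheory Polynomial

noncomputable section

namespace OrthogonalEnsemble

/-- Unnormalized joint eigenvalue density of the `β = 1` ensemble,
`exp (-(n/2) ∑ V(λ_j)) * ∏_{j<k} |λ_j - λ_k|`. -/
def jointWeight (n : ℕ) (V : ℝ → ℝ) (x : Fin n → ℝ) : ℝ :=
  Real.exp (-((n : ℝ) / 2) * ∑ j, V (x j)) *
    ∏ j : Fin n, ∏ k ∈ Finset.Ioi j, |x j - x k|

/-- The normalizing constant. -/
def partitionFunction (n : ℕ) (V : ℝ → ℝ) : ℝ :=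
  ∫ x : Fin n → ℝ, jointWeight n V x

/-- The joint eigenvalue density. -/
def jointDensity (n : ℕ) (V : ℝ → ℝ) (x : Fin n → ℝ) : ℝ :=
  (partitionFunction n V)⁻¹ * jointWeight n V x

/-- The joint law of the eigenvalues `(λ_1, …, λ_n)`. -/
def eigenvalueLaw (n : ℕ) (V : ℝ → ℝ) : Measure (Fin n → ℝ) :=
  volume.withDensity fun x => ENNReal.ofReal (jointDensity n V x)

/-- The linear statistic `φ(λ_1) + … + φ(λ_n)`. -/
def linearStatistic (n : ℕ) (φ : ℝ → ℝ) (x : Fin n → ℝ) : ℝ :=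
  ∑ j, φ (x j)

/-- The weight `w_n = exp (-n V)`. -/
def weight (n : ℕ) (V : ℝ → ℝ) (x : ℝ) : ℝ :=
  Real.exp (-(n : ℝ) * V x)

/-- Monic orthogonal polynomials of a weight `w`, by the Gram-Schmidt procedure applied to
`1, X, X ^ 2, …`. -/
def monicOrthPoly (w : ℝ → ℝ) (l : ℕ) : ℝ[X] :=
  X ^ l - ∑ k : Fin l,
    C ((∫ x, x ^ l * (monicOrthPoly w k).eval x * w x) /
        ∫ x, (monicOrthPoly w k).eval x ^ 2 * w x) * monicOrthPoly w k
termination_by l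
decreasing_by all_goals exact k.isLt

/-- Orthonormal polynomials (with positive leading coefficients) of a weight `w`. -/
def orthPoly (w : ℝ → ℝ) (l : ℕ) : ℝ[X] :=
  C (Real.sqrt (∫ x, (monicOrthPoly w l).eval x ^ 2 * w x))⁻¹ * monicOrthPoly w l

/-- `ψ_l = w_n ^ (1/2) * p_l`. -/
def psi (n : ℕ) (V : ℝ → ℝ) (l : ℕ) (x : ℝ) : ℝ :=
  Real.sqrt (weight n V x) * (orthPoly (weight n V) l).eval x

/-- The kernel `ε(λ) = sign(λ) / 2` (with `ε(0) = 0`). -/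
def eps (x : ℝ) : ℝ := Real.sign x / 2

/-- The integral operator `(ε f)(λ) = ∫ ε(λ - μ) f(μ) dμ`. -/
def epsOp (f : ℝ → ℝ) (x : ℝ) : ℝ := ∫ y, eps (x - y) * f y

/-- The matrix `M_{j,l} = n (ψ_j, ε ψ_l)`, `0 ≤ j, l ≤ n - 1`. -/
def skewMatrix (n : ℕ) (V : ℝ → ℝ) : Matrix (Fin n) (Fin n) ℝ :=
  Matrix.of fun j l => (n : ℝ) * ∫ x, psi n V j x * epsOp (psi n V l) x

/-- `S_n(λ, μ) = - ∑ ψ_i(λ) (M⁻¹)_{i,j} (n ε ψ_j)(μ)`. -/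
def kernelS (n : ℕ) (V : ℝ → ℝ) (x y : ℝ) : ℝ :=
  -∑ i : Fin n, ∑ j : Fin n,
    psi n V i x * (skewMatrix n V)⁻¹ i j * ((n : ℝ) * epsOp (psi n V j) y)

/-- `S_n d(λ, μ) = - ∂/∂μ S_n(λ, μ)`. -/
def kernelSd (n : ℕ) (V : ℝ → ℝ) (x y : ℝ) : ℝ :=
  -deriv (fun z => kernelS n V x z) y

/-- `I S_n(λ, μ) = ∫ ε(λ - λ') S_n(λ', μ) dλ'`. -/
def kernelIS (n : ℕ) (V : ℝ → ℝ) (x y : ℝ) : ℝ :=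
  epsOp (fun z => kernelS n V z y) x

/-- The Tracy-Widom matrix kernel of the `β = 1` ensemble. -/
def matrixKernel (n : ℕ) (V : ℝ → ℝ) (x y : ℝ) : Matrix (Fin 2) (Fin 2) ℝ :=
  !![kernelS n V x y, kernelSd n V x y;
     kernelIS n V x y - eps (x - y), kernelS n V y x]

end OrthogonalEnsemble

end

noncomputable section

namespace OrthogonalEnsemble

/-! ### Signs of differences -/

/-! Write `|Δ| = Δ · sign Δ` for the Vandermonde determinant `Δ`. Column operations turn `Δ` times
the square-root weights into a constant times `det ψ_j(x_i)`; this needs only that `p_l` has degree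
exactly `l`, orthogonality plays no role. Expanding the determinant and permuting coordinates shows
that the expectation of a bounded symmetric statistic `h` is the ratio of `∫ h ∏ ψ_j(x_j) sign Δ` to
the same integral `F` with `h = 1` (`signedIntegral_mul_integral_eigenvalueLaw`). Here `F ≠ 0`,
because it is a nonzero multiple of the positive partition function.

For even `n`, `sign Δ` is the Pfaffian of the matrix of signs of differences, so `F` is a Pfaffian
of the skew Gram matrix `M` up to a constant. Pfaffians themselves are never introduced: all that is
used is the expansion along one row, `F(φ) = ∑_k ⟨φ_i, φ_k⟩ G_k`, where `G_k` does not involve `φ_i`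
or `φ_k`. Since `F` vanishes when two of its functions agree, the normalized cofactors form an
inverse of `M` (`exists_row_expansion`). Replacing one or two of the functions then changes `F` by
explicit expressions in `M⁻¹` (`signedIntegral_update_update`).

Putting `f ψ_i` and `g ψ_j` into two slots and summing gives, for bounded `f` and `g`, `E ∑_{i≠j}
f(λ_i) g(λ_j) = E ∑ f(λ_i) · E ∑ g(λ_j) - ∬ f g T`, where `T` is half the trace in the theorem. With
indicators this is an identity of measures, `ρ₂ + T⁺ = ρ₁ ⊗ ρ₁ + T⁻`. It yields `T⁺ ≤ ρ₁ ⊗ ρ₁` and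
`T⁻ ≤ ρ₂`, hence integrability against `T` for unbounded square-integrable `φ`. Integrating `(φ(x) -
φ(y))²`, the second-moment terms cancel and `∬ (φ(x) - φ(y))² T = 2 Var` remains. -/

theorem sign_mul (a b : ℝ) : Real.sign (a * b) = Real.sign a * Real.sign b := by
  rcases lt_trichotomy a 0 with ha | rfl | ha <;> rcases lt_trichotomy b 0 with hb | rfl | hb <;>
    simp [Real.sign_of_neg, Real.sign_of_pos, mul_pos_of_neg_of_neg, mul_neg_of_neg_of_pos,
      mul_neg_of_pos_of_neg, *]

theorem sign_prod {ι : Type*} (s : Finset ι) (f : ι → ℝ) :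
    Real.sign (∏ i ∈ s, f i) = ∏ i ∈ s, Real.sign (f i) := by
  classical
  induction s using Finset.induction_on with
  | empty => simp
  | insert a s ha ih => rw [Finset.prod_insert ha, Finset.prod_insert ha, sign_mul, ih]

theorem mul_sign_self (a : ℝ) : a * Real.sign a = |a| := by
  rcases lt_trichotomy a 0 with ha | rfl | ha
  · rw [Real.sign_of_neg ha, abs_of_neg ha]; ring
  · simp
  · rw [Real.sign_of_pos ha, abs_of_pos ha]; ring

theorem sign_sub_comm (a b : ℝ) : Real.sign (a - b) = -Real.sign (b - a) := by
  rw [← Real.sign_neg, neg_sub]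

theorem sign_mul_sign_self {a : ℝ} (ha : a ≠ 0) : Real.sign a * Real.sign a = 1 := by
  rcases Real.sign_apply_eq_of_ne_zero a ha with h | h <;> rw [h] <;> norm_num

theorem abs_sign_le_one (a : ℝ) : |Real.sign a| ≤ 1 := by
  rcases Real.sign_apply_eq a with h | h | h <;> rw [h] <;> norm_num

theorem measurable_sign : Measurable Real.sign := by
  unfold Real.sign
  exact Measurable.ite measurableSet_Iio measurable_const
    (Measurable.ite measurableSet_Ioi measurable_const measurable_const)

/-- The first-row expansion of the Pfaffian of a sign matrix, divided by that Pfaffian. -/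
theorem sum_sign_mul_prod_sign {ι : Type*} [DecidableEq ι] (x : ι → ℝ) (a : ℝ) (m : ℕ) :
    ∀ T : Finset ι, T.card = 2 * m + 1 → Set.InjOn x T → (∀ k ∈ T, x k ≠ a) →
      ∑ k ∈ T, Real.sign (x k - a) * ∏ j ∈ T.erase k, Real.sign (x k - x j) =
        ∏ j ∈ T, Real.sign (x j - a) := by
  induction m with
  | zero =>
    intro T hT _ _
    obtain ⟨k, rfl⟩ := Finset.card_eq_one.1 hT
    simp
  | succ m ih =>
    intro T hT hinj hne
    -- Remove the two largest points `u` and `v`: every other point lies below both, so they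
    -- contribute two factors `-1` to each remaining product, which cancel.
    obtain ⟨u, huT, hu⟩ := T.exists_max_image x (Finset.card_pos.1 (by omega))
    obtain ⟨v, hvT, hv⟩ := (T.erase u).exists_max_image x
      (Finset.card_pos.1 (by rw [Finset.card_erase_of_mem huT]; omega))
    obtain ⟨S, hS⟩ : ∃ S, S = (T.erase u).erase v := ⟨_, rfl⟩
    have hvS : v ∉ S := by simp [hS]
    have huS : u ∉ insert v S := by
      simp only [hS, Finset.insert_erase hvT]; simp
    have hTS : T = insert u (insert v S) := by
      rw [hS, Finset.insert_erase hvT, Finset.insert_erase huT]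
    have hcard : S.card = 2 * m + 1 := by
      rw [hS, Finset.card_erase_of_mem hvT, Finset.card_erase_of_mem huT]; omega
    have hvT' : v ∈ T := Finset.mem_of_mem_erase hvT
    have hvu : x v < x u := lt_of_le_of_ne (hu v hvT') fun h =>
      (Finset.ne_of_mem_erase hvT) (hinj hvT' huT h)
    have hlt : ∀ j ∈ S, x j < x v := by
      intro j hj
      rw [hS, Finset.mem_erase] at hj
      exact lt_of_le_of_ne (hv j hj.2) fun h => hj.1 (hinj (Finset.mem_of_mem_erase hj.2) hvT' h)
    have hSne : ∀ j ∈ S, j ≠ u ∧ j ≠ v := by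
      intro j hj
      exact ⟨fun h => huS (h ▸ Finset.mem_insert_of_mem hj), fun h => hvS (h ▸ hj)⟩
    have huv : u ≠ v := fun h => huS (h ▸ Finset.mem_insert_self _ _)
    have hST : S ⊆ T := by
      rw [hTS]; exact (Finset.subset_insert _ _).trans (Finset.subset_insert _ _)
    have ihS := ih S hcard (hinj.mono (by exact_mod_cast hST)) fun k hk => hne k (hST hk)
    have hone : ∀ b, x v ≤ b → ∏ j ∈ S, Real.sign (b - x j) = 1 := fun b hb =>
      Finset.prod_eq_one fun j hj => Real.sign_of_pos (by linarith [hlt j hj])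
    have hsum : ∑ k ∈ S, Real.sign (x k - a) * ∏ j ∈ T.erase k, Real.sign (x k - x j) =
        ∏ j ∈ S, Real.sign (x j - a) := by
      rw [← ihS]
      refine Finset.sum_congr rfl fun k hk => ?_
      have h1 : T.erase k = insert u (insert v (S.erase k)) := by
        rw [hTS, Finset.erase_insert_of_ne (hSne k hk).1.symm,
          Finset.erase_insert_of_ne (hSne k hk).2.symm]
      have h2 : v ∉ S.erase k := fun h => hvS (Finset.mem_of_mem_erase h)
      have h3 : u ∉ insert v (S.erase k) := by
        intro h
        rcases Finset.mem_insert.1 h with h | h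
        · exact huv h
        · exact huS (Finset.mem_insert_of_mem (Finset.mem_of_mem_erase h))
      rw [h1, Finset.prod_insert h3, Finset.prod_insert h2,
        Real.sign_of_neg (by linarith [hlt k hk] : x k - x u < 0),
        Real.sign_of_neg (by linarith [hlt k hk] : x k - x v < 0)]
      ring
    have hTu : T.erase u = insert v S := by rw [hTS, Finset.erase_insert huS]
    have hTv : T.erase v = insert u S := by
      rw [hTS, Finset.erase_insert_of_ne huv, Finset.erase_insert hvS]
    have huS' : u ∉ S := fun h => huS (Finset.mem_insert_of_mem h)
    have huterm : ∏ j ∈ T.erase u, Real.sign (x u - x j) = 1 := by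
      rw [hTu, Finset.prod_insert hvS, hone _ hvu.le, Real.sign_of_pos (by linarith), one_mul]
    have hvterm : ∏ j ∈ T.erase v, Real.sign (x v - x j) = -1 := by
      rw [hTv, Finset.prod_insert huS', hone _ le_rfl, Real.sign_of_neg (by linarith), mul_one]
    have hsplit : ∀ f : ι → ℝ, ∑ k ∈ T, f k = f u + (f v + ∑ k ∈ S, f k) := fun f => by
      rw [hTS, Finset.sum_insert huS, Finset.sum_insert hvS]
    have hsplit' : ∀ f : ι → ℝ, ∏ k ∈ T, f k = f u * (f v * ∏ k ∈ S, f k) := fun f => by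
      rw [hTS, Finset.prod_insert huS, Finset.prod_insert hvS]
    rw [hsplit, hsplit', hsum, huterm, hvterm]
    -- With `s_u`, `s_v` the signs of `x u - a`, `x v - a` and `P` the product over `S`, the claim
    -- is `s_u - s_v + P = s_u s_v P`. It is immediate unless `x v < a < x u`; in that case `P =
    -- -1`, because `S` has odd cardinality.
    rcases lt_or_gt_of_ne (hne u huT) with h | h
    · rw [Real.sign_of_neg (by linarith : x u - a < 0),
        Real.sign_of_neg (by linarith : x v - a < 0)]; ring
    · rcases lt_or_gt_of_ne (hne v hvT') with h' | h'
      · have : ∏ j ∈ S, Real.sign (x j - a) = -1 := by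
          rw [Finset.prod_congr rfl fun j hj =>
            Real.sign_of_neg (by linarith [hlt j hj] : x j - a < 0)]
          rw [Finset.prod_const, hcard, pow_succ, pow_mul]; norm_num
        rw [Real.sign_of_pos (by linarith : 0 < x u - a),
          Real.sign_of_neg (by linarith : x v - a < 0), this]; norm_num
      · rw [Real.sign_of_pos (by linarith : 0 < x u - a),
          Real.sign_of_pos (by linarith : 0 < x v - a)]; ring

/-- The sign of the Vandermonde product of the points indexed by `T`. -/
def pairSign {n : ℕ} (T : Finset (Fin n)) (x : Fin n → ℝ) : ℝ :=
  ∏ p ∈ T, ∏ q ∈ T, if p < q then Real.sign (x q - x p) else 1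

/-- The pairs containing `i` are written with the uniform orientation `x j - x i`; each `j < i`
costs a sign. -/
theorem pairSign_insert {n : ℕ} {T : Finset (Fin n)} {i : Fin n} (hi : i ∉ T) (x : Fin n → ℝ) :
    pairSign (insert i T) x =
      (∏ j ∈ T, if j < i then -1 else 1) * (∏ j ∈ T, Real.sign (x j - x i)) * pairSign T x := by
  unfold pairSign
  simp only [Finset.prod_insert hi, lt_irrefl, if_false, one_mul, Finset.prod_mul_distrib]
  rw [← mul_assoc]
  refine congrArg (· * _) ?_
  rw [← Finset.prod_mul_distrib, ← Finset.prod_mul_distrib]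
  refine Finset.prod_congr rfl fun j hj => ?_
  rcases lt_or_gt_of_ne (fun h : j = i => hi (h ▸ hj)) with h | h
  · rw [if_neg h.not_gt, if_pos h, if_pos h, sign_sub_comm (x i)]; ring
  · rw [if_neg h.not_gt, if_pos h, if_neg h.not_gt]; ring

theorem measurable_pairSign {n : ℕ} (T : Finset (Fin n)) : Measurable (pairSign T) := by
  unfold pairSign
  refine Finset.measurable_fun_prod _ fun p _ => Finset.measurable_fun_prod _ fun q _ => ?_
  split_ifs
  · exact measurable_sign.comp ((measurable_pi_apply q).sub (measurable_pi_apply p))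
  · exact measurable_const

theorem abs_pairSign_le_one {n : ℕ} (T : Finset (Fin n)) (x : Fin n → ℝ) :
    |pairSign T x| ≤ 1 := by
  unfold pairSign
  rw [Finset.abs_prod]
  refine Finset.prod_le_one (fun _ _ => abs_nonneg _) fun p _ => ?_
  rw [Finset.abs_prod]
  refine Finset.prod_le_one (fun _ _ => abs_nonneg _) fun q _ => ?_
  split_ifs
  · exact abs_sign_le_one _
  · simp

theorem pairSign_congr {n : ℕ} {T : Finset (Fin n)} {x y : Fin n → ℝ}
    (h : ∀ j ∈ T, x j = y j) : pairSign T x = pairSign T y := by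
  unfold pairSign
  refine Finset.prod_congr rfl fun p hp => Finset.prod_congr rfl fun q hq => ?_
  rw [h p hp, h q hq]

/-- The sign of the Vandermonde determinant. -/
def vandermondeSign {n : ℕ} (x : Fin n → ℝ) : ℝ := pairSign Finset.univ x

theorem vandermondeSign_eq_sign_det {n : ℕ} (x : Fin n → ℝ) :
    vandermondeSign x = Real.sign (Matrix.vandermonde x).det := by
  rw [Matrix.det_vandermonde, sign_prod]
  unfold vandermondeSign pairSign
  refine Finset.prod_congr rfl fun p _ => ?_
  rw [sign_prod, ← Finset.prod_filter]
  exact Finset.prod_congr (by ext; simp) fun _ _ => rfl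

theorem vandermondeSign_perm {n : ℕ} (x : Fin n → ℝ) (π : Equiv.Perm (Fin n)) :
    vandermondeSign (x ∘ π) = (Equiv.Perm.sign π : ℤ) * vandermondeSign x := by
  rw [vandermondeSign_eq_sign_det, vandermondeSign_eq_sign_det]
  have : Matrix.vandermonde (x ∘ π) = (Matrix.vandermonde x).submatrix π id := by
    ext i j; simp [Matrix.vandermonde]
  rw [this, Matrix.det_permute, sign_mul]
  congr 1
  rcases Int.units_eq_one_or (Equiv.Perm.sign π) with h | h <;> rw [h] <;>
    simp [Real.sign_neg]

/-- Expansion of the Vandermonde sign along the `i`-th row of the sign matrix. -/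
theorem exists_vandermondeSign_eq_sum {n : ℕ} (hn : Even n) (i : Fin n) :
    ∃ c : Fin n → ℝ, ∀ x : Fin n → ℝ, Function.Injective x →
      vandermondeSign x = ∑ k ∈ Finset.univ.erase i,
        Real.sign (x i - x k) * (c k * pairSign ((Finset.univ.erase i).erase k) x) := by
  classical
  -- The coefficient depends only on the order of indices. The first two products reorient the pairs
  -- when `i` and then `k` are split off, the powers of `-1` come from `sign(x k - x j) sign(x j - x
  -- k) = -1`, and the leading minus sign turns `sign(x k - x i)` into `sign(x i - x k)`.
  refine ⟨fun k => -((∏ j ∈ Finset.univ.erase i, if j < i then (-1 : ℝ) else 1) *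
    ((∏ j ∈ (Finset.univ.erase i).erase k, if j < k then (-1 : ℝ) else 1) *
      ∏ _j ∈ (Finset.univ.erase i).erase k, (-1 : ℝ))), fun x hx => ?_⟩
  obtain ⟨m, hm⟩ := hn
  have hcard : (Finset.univ.erase i).card = 2 * (m - 1) + 1 := by
    rw [Finset.card_erase_of_mem (Finset.mem_univ _), Finset.card_univ, Fintype.card_fin]
    have := i.pos
    omega
  have key := sum_sign_mul_prod_sign x (x i) (m - 1) (Finset.univ.erase i) hcard
    hx.injOn (fun k hk => hx.ne (Finset.ne_of_mem_erase hk))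
  have hins := pairSign_insert (Finset.notMem_erase i Finset.univ) x
  rw [Finset.insert_erase (Finset.mem_univ i), ← key] at hins
  rw [vandermondeSign, hins, mul_assoc, Finset.sum_mul, Finset.mul_sum]
  refine Finset.sum_congr rfl fun k hk => ?_
  have hk' := pairSign_insert (Finset.notMem_erase k (Finset.univ.erase i)) x
  rw [Finset.insert_erase hk] at hk'
  have hprod : (∏ j ∈ (Finset.univ.erase i).erase k, Real.sign (x k - x j)) *
      (∏ j ∈ (Finset.univ.erase i).erase k, Real.sign (x j - x k)) =
        ∏ _j ∈ (Finset.univ.erase i).erase k, (-1 : ℝ) := by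
    rw [← Finset.prod_mul_distrib]
    refine Finset.prod_congr rfl fun j hj => ?_
    rw [sign_sub_comm (x k), neg_mul,
      sign_mul_sign_self (sub_ne_zero.2 (hx.ne (Finset.ne_of_mem_erase hj)))]
  beta_reduce
  rw [hk', sign_sub_comm (x k), ← hprod]
  ring

/-! ### Signed integrals -/

/-- Each hyperplane `x p = x q` is a null set, so the row expansion, valid only for distinct points,
may be integrated. -/
theorem ae_injective (n : ℕ) : ∀ᵐ x : Fin n → ℝ, Function.Injective x := by
  have h : ∀ p q : Fin n, ∀ᵐ x : Fin n → ℝ, p ≠ q → x p ≠ x q := by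
    intro p q
    by_cases hpq : p = q
    · exact Filter.Eventually.of_forall fun x h => absurd hpq h
    let L : (Fin n → ℝ) →ₗ[ℝ] ℝ :=
      LinearMap.proj (R := ℝ) (φ := fun _ => ℝ) p - LinearMap.proj (R := ℝ) (φ := fun _ => ℝ) q
    have hL : LinearMap.ker L ≠ ⊤ := by
      intro h
      have : (Pi.single p 1 : Fin n → ℝ) ∈ LinearMap.ker L := h ▸ Submodule.mem_top
      simp [L, Pi.single_eq_of_ne (Ne.symm hpq)] at this
    have h0 := Measure.addHaar_submodule (volume : Measure (Fin n → ℝ)) _ hL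
    filter_upwards [measure_eq_zero_iff_ae_notMem.1 h0] with x hx _ he
    exact hx (by simp [L, he])
  have h' : ∀ᵐ x : Fin n → ℝ, ∀ p q : Fin n, p ≠ q → x p ≠ x q :=
    ae_all_iff.2 fun p => ae_all_iff.2 fun q => h p q
  filter_upwards [h'] with x hx p q hpq
  by_contra hne
  exact hx p q hne hpq

/-- Fubini, with the coordinates `i` and `k` separated from the others. -/
theorem integral_pair_mul {n : ℕ} {i k : Fin n} (hik : i ≠ k) (h : ℝ × ℝ → ℝ)
    (g : ({j : Fin n // ¬(j = i ∨ j = k)} → ℝ) → ℝ) :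
    ∫ x : Fin n → ℝ, h (x i, x k) * g (fun j => x j) = (∫ z, h z) * ∫ y, g y := by
  have hbij : Function.Bijective
      (![⟨i, Or.inl rfl⟩, ⟨k, Or.inr rfl⟩] : Fin 2 → {j : Fin n // j = i ∨ j = k}) := by
    constructor
    · intro a b hab
      fin_cases a <;> fin_cases b <;> simp_all [hik.symm]
    · rintro ⟨j, rfl | rfl⟩
      · exact ⟨0, rfl⟩
      · exact ⟨1, rfl⟩
  let f := Equiv.ofBijective _ hbij
  have e1 := volume_preserving_piEquivPiSubtypeProd (fun _ : Fin n => ℝ) (fun j => j = i ∨ j = k)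
  have e2 := (volume_preserving_finTwoArrow ℝ).comp
    (MeasurePreserving.symm _ (volume_measurePreserving_piCongrLeft
      (fun _ : {j : Fin n // j = i ∨ j = k} => ℝ) f))
  have e3 := (e2.prod (MeasurePreserving.id
    (volume : Measure ({j : Fin n // ¬(j = i ∨ j = k)} → ℝ)))).comp e1
  let E := (MeasurableEquiv.piEquivPiSubtypeProd (fun _ : Fin n => ℝ)
      (fun j => j = i ∨ j = k)).trans
    (((MeasurableEquiv.piCongrLeft (fun _ : {j : Fin n // j = i ∨ j = k} => ℝ) f).symm.trans
      MeasurableEquiv.finTwoArrow).prodCongr (MeasurableEquiv.refl _))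
  have hE : MeasurePreserving E := e3
  have := hE.integral_comp' (g := fun z => h z.1 * g z.2)
  rw [← integral_prod_mul]
  exact this

/-- The Pfaffian-like integral of `∏ φ_j(x_j)` against the Vandermonde sign. -/
def signedIntegral {n : ℕ} (φ : Fin n → ℝ → ℝ) : ℝ :=
  ∫ x : Fin n → ℝ, (∏ j, φ j (x j)) * vandermondeSign x

/-- The skew form `n (g, ε h)`. -/
def skewForm (n : ℕ) (g h : ℝ → ℝ) : ℝ := (n : ℝ) * ∫ x, g x * epsOp h x

theorem integrable_prod_mul {n : ℕ} {φ : Fin n → ℝ → ℝ} (hφ : ∀ j, Integrable (φ j))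
    {b : (Fin n → ℝ) → ℝ} (hb : Measurable b) {C : ℝ} (hC : ∀ x, |b x| ≤ C) :
    Integrable fun x : Fin n → ℝ => (∏ j, φ j (x j)) * b x :=
  (Integrable.fintype_prod hφ).mul_bdd (c := C) hb.aestronglyMeasurable (Filter.Eventually.of_forall hC)

theorem measurable_eps : Measurable eps := measurable_sign.div_const 2

theorem abs_eps_le (x : ℝ) : |eps x| ≤ 1 / 2 := by
  unfold eps
  rw [abs_div, abs_two]
  linarith [abs_sign_le_one x]

theorem eps_neg (x : ℝ) : eps (-x) = -eps x := by
  unfold eps; rw [Real.sign_neg]; ring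

theorem integrable_mul_mul_eps {g h : ℝ → ℝ} (hg : Integrable g) (hh : Integrable h) :
    Integrable fun z : ℝ × ℝ => g z.1 * h z.2 * eps (z.1 - z.2) :=
  (hg.mul_prod hh).mul_bdd (c := 1 / 2)
    (measurable_eps.comp (measurable_fst.sub measurable_snd)).aestronglyMeasurable
    (Filter.Eventually.of_forall fun z => abs_eps_le (z.1 - z.2))

theorem skewForm_eq_integral_prod (n : ℕ) {g h : ℝ → ℝ} (hg : Integrable g) (hh : Integrable h) :
    skewForm n g h = n * ∫ z : ℝ × ℝ, g z.1 * h z.2 * eps (z.1 - z.2) := by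
  unfold skewForm epsOp
  rw [Measure.volume_eq_prod, integral_prod _ (integrable_mul_mul_eps hg hh)]
  congr 2
  ext x
  rw [← integral_const_mul]
  congr 1
  ext y
  ring

/-- Row expansion of the signed integral. -/
theorem exists_signedIntegral_eq_sum {n : ℕ} (hn : Even n) (i : Fin n) :
    ∃ G : Fin n → (Fin n → ℝ → ℝ) → ℝ,
      (∀ k φ φ', (∀ j, j ≠ i → j ≠ k → φ j = φ' j) → G k φ = G k φ') ∧
      ∀ φ : Fin n → ℝ → ℝ, (∀ j, Integrable (φ j)) →
        signedIntegral φ = ∑ k ∈ Finset.univ.erase i, skewForm n (φ i) (φ k) * G k φ := by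
  classical
  obtain ⟨c, hc⟩ := exists_vandermondeSign_eq_sum hn i
  have hn0 : (n : ℝ) ≠ 0 := by exact_mod_cast i.pos.ne'
  -- The filler value `0` at `i` and `k` is harmless: `pairSign (S k)` does not look at those
  -- coordinates.
  let ext (k : Fin n) (y : {j : Fin n // ¬(j = i ∨ j = k)} → ℝ) : Fin n → ℝ :=
    fun j => if h : ¬(j = i ∨ j = k) then y ⟨j, h⟩ else 0
  let S (k : Fin n) : Finset (Fin n) := (Finset.univ.erase i).erase k
  let r (k : Fin n) (φ : Fin n → ℝ → ℝ) (y : {j : Fin n // ¬(j = i ∨ j = k)} → ℝ) : ℝ :=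
    (∏ j : {j : Fin n // ¬(j = i ∨ j = k)}, φ j (y j)) * (c k * pairSign (S k) (ext k y))
  -- The factor `2 / n` compensates for `eps` being half the sign and for the `n` in `skewForm`.
  refine ⟨fun k φ => 2 / n * ∫ y, r k φ y, ?_, ?_⟩
  · intro k φ φ' h
    have : r k φ = r k φ' := by
      funext y
      simp only [r]
      congr 1
      refine Finset.prod_congr rfl fun j _ => ?_
      have hj := not_or.1 j.2
      rw [h j hj.1 hj.2]
    beta_reduce
    rw [this]
  · intro φ hφ
    have hterm : ∀ k ∈ Finset.univ.erase i, ∀ x : Fin n → ℝ,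
        (∏ j, φ j (x j)) * (Real.sign (x i - x k) * (c k * pairSign (S k) x)) =
          (fun z : ℝ × ℝ => 2 * (φ i z.1 * φ k z.2 * eps (z.1 - z.2))) (x i, x k) *
            r k φ (fun j => x j) := by
      intro k hk x
      have hik : i ≠ k := (Finset.ne_of_mem_erase hk).symm
      have h1 : ∏ j, φ j (x j) = φ i (x i) * φ k (x k) *
          ∏ j : {j : Fin n // ¬(j = i ∨ j = k)}, φ j (x j) := by
        rw [← Fintype.prod_subtype_mul_prod_subtype (fun j => j = i ∨ j = k)
          (fun j => φ j (x j))]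
        congr 1
        rw [← Finset.prod_subtype ({i, k} : Finset (Fin n)) (by simp)
          (fun j => φ j (x j)), Finset.prod_pair hik]
      have h2 : pairSign (S k) (ext k fun j => x j) = pairSign (S k) x := by
        refine pairSign_congr fun j hj => ?_
        simp only [S, Finset.mem_erase] at hj
        simp only [ext]
        rw [dif_pos (by tauto)]
      simp only [r, h1, h2, eps]
      ring
    have hint : ∀ k ∈ Finset.univ.erase i, Integrable fun x : Fin n → ℝ =>
        (∏ j, φ j (x j)) * (Real.sign (x i - x k) * (c k * pairSign (S k) x)) := by
      intro k _
      refine integrable_prod_mul hφ (C := |c k|) ?_ ?_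
      · exact (measurable_sign.comp ((measurable_pi_apply i).sub (measurable_pi_apply k))).mul
          (measurable_const.mul (measurable_pairSign _))
      · intro x
        rw [abs_mul, abs_mul]
        have h1 := abs_sign_le_one (x i - x k)
        have h2 := abs_pairSign_le_one (S k) x
        calc _ ≤ 1 * (|c k| * 1) := by gcongr
          _ = _ := by ring
    have hae : signedIntegral φ = ∫ x : Fin n → ℝ, ∑ k ∈ Finset.univ.erase i,
        (∏ j, φ j (x j)) * (Real.sign (x i - x k) * (c k * pairSign (S k) x)) := by
      refine integral_congr_ae ?_
      filter_upwards [ae_injective n] with x hx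
      rw [hc x hx, Finset.mul_sum]
    rw [hae, integral_finsetSum _ hint]
    refine Finset.sum_congr rfl fun k hk => ?_
    rw [integral_congr_ae (Filter.Eventually.of_forall (hterm k hk)),
      integral_pair_mul (Finset.ne_of_mem_erase hk).symm
        (fun z : ℝ × ℝ => 2 * (φ i z.1 * φ k z.2 * eps (z.1 - z.2))) (r k φ), integral_const_mul,
      skewForm_eq_integral_prod n (hφ i) (hφ k)]
    field_simp

theorem piCongrLeft_eq_comp {n : ℕ} (π : Equiv.Perm (Fin n)) (x : Fin n → ℝ) :
    MeasurableEquiv.piCongrLeft (fun _ : Fin n => ℝ) π x = x ∘ π.symm := by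
  funext j
  obtain ⟨k, rfl⟩ := π.surjective j
  rw [MeasurableEquiv.coe_piCongrLeft, Equiv.piCongrLeft_apply_apply]
  simp

/-- Permuting the functions amounts to permuting the variables, under which Lebesgue measure is
invariant and the Vandermonde sign is alternating. -/
theorem signedIntegral_comp_perm {n : ℕ} (φ : Fin n → ℝ → ℝ) (π : Equiv.Perm (Fin n)) :
    signedIntegral (φ ∘ π) = (Equiv.Perm.sign π : ℤ) * signedIntegral φ := by
  unfold signedIntegral
  have h := (volume_measurePreserving_piCongrLeft (fun _ : Fin n => ℝ) π).integral_comp'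
    (g := fun x => (∏ j, φ j (x j)) * vandermondeSign x)
  rw [← h, ← integral_const_mul]
  congr 1
  ext x
  rw [piCongrLeft_eq_comp, vandermondeSign_perm, ← Equiv.prod_comp π fun j => φ j ((x ∘ π.symm) j)]
  simp only [Function.comp_apply, Equiv.symm_apply_apply, Equiv.Perm.sign_symm]
  rcases Int.units_eq_one_or (Equiv.Perm.sign π) with h | h <;> rw [h] <;> simp

/-! ### Algebra of the skew form -/

theorem skewForm_swap (n : ℕ) {g h : ℝ → ℝ} (hg : Integrable g) (hh : Integrable h) :
    skewForm n h g = -skewForm n g h := by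
  rw [skewForm_eq_integral_prod n hg hh, skewForm_eq_integral_prod n hh hg,
    Measure.volume_eq_prod,
    ← integral_prod_swap (fun z : ℝ × ℝ => h z.1 * g z.2 * eps (z.1 - z.2)), ← mul_neg,
    ← integral_neg]
  congr 2
  ext z
  simp only [Prod.fst_swap, Prod.snd_swap]
  rw [← neg_sub z.1 z.2, eps_neg]
  ring

theorem integrable_sub_sum {ι : Type*} [Fintype ι] {g : ℝ → ℝ} {φ : ι → ℝ → ℝ}
    (hg : Integrable g) (hφ : ∀ k, Integrable (φ k)) (c : ι → ℝ) :
    Integrable fun x => g x - ∑ k, c k * φ k x :=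
  hg.sub (integrable_finsetSum _ fun k _ => (hφ k).const_mul (c k))

theorem skewForm_sub_sum {ι : Type*} [Fintype ι] (n : ℕ) {g h : ℝ → ℝ} {φ : ι → ℝ → ℝ}
    (hg : Integrable g) (hφ : ∀ k, Integrable (φ k)) (hh : Integrable h) (c : ι → ℝ) :
    skewForm n (fun x => g x - ∑ k, c k * φ k x) h =
      skewForm n g h - ∑ k, c k * skewForm n (φ k) h := by
  rw [skewForm_eq_integral_prod n (integrable_sub_sum hg hφ c) hh,
    skewForm_eq_integral_prod n hg hh]
  simp only [skewForm_eq_integral_prod n (hφ _) hh]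
  have h1 : ∀ z : ℝ × ℝ, (g z.1 - ∑ k, c k * φ k z.1) * h z.2 * eps (z.1 - z.2) =
      g z.1 * h z.2 * eps (z.1 - z.2) - ∑ k, c k * (φ k z.1 * h z.2 * eps (z.1 - z.2)) := by
    intro z
    rw [sub_mul, sub_mul, Finset.sum_mul, Finset.sum_mul]
    simp only [mul_assoc]
  simp only [h1]
  have h2 : ∀ k ∈ Finset.univ, Integrable
      fun z : ℝ × ℝ => c k * (φ k z.1 * h z.2 * eps (z.1 - z.2)) :=
    fun k _ => (integrable_mul_mul_eps (hφ k) hh).const_mul _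
  rw [integral_sub (integrable_mul_mul_eps hg hh) (integrable_finsetSum _ h2),
    integral_finsetSum _ h2, mul_sub, Finset.mul_sum]
  congr 1
  refine Finset.sum_congr rfl fun k _ => ?_
  rw [integral_const_mul]
  ring

theorem prod_update_apply {n : ℕ} (φ : Fin n → ℝ → ℝ) (i : Fin n) (g : ℝ → ℝ) (x : Fin n → ℝ) :
    ∏ j, Function.update φ i g j (x j) = g (x i) * ∏ j ∈ Finset.univ.erase i, φ j (x j) := by
  rw [← Finset.mul_prod_erase _ _ (Finset.mem_univ i), Function.update_self]
  congr 1
  exact Finset.prod_congr rfl fun j hj => by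
    rw [Function.update_of_ne (Finset.ne_of_mem_erase hj)]

theorem integrable_update {n : ℕ} {φ : Fin n → ℝ → ℝ} (hφ : ∀ j, Integrable (φ j)) (i : Fin n)
    {g : ℝ → ℝ} (hg : Integrable g) (j : Fin n) : Integrable (Function.update φ i g j) := by
  rcases eq_or_ne j i with rfl | h
  · rwa [Function.update_self]
  · rw [Function.update_of_ne h]; exact hφ j

theorem integrable_signed {n : ℕ} {φ : Fin n → ℝ → ℝ} (hφ : ∀ j, Integrable (φ j)) :
    Integrable fun x : Fin n → ℝ => (∏ j, φ j (x j)) * vandermondeSign x :=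
  integrable_prod_mul hφ (measurable_pairSign _) (abs_pairSign_le_one _)

theorem signedIntegral_update_sub_sum {ι : Type*} [Fintype ι] {n : ℕ} {φ : Fin n → ℝ → ℝ}
    (hφ : ∀ j, Integrable (φ j)) (i : Fin n) {g : ℝ → ℝ} {h : ι → ℝ → ℝ} (hg : Integrable g)
    (hh : ∀ k, Integrable (h k)) (c : ι → ℝ) :
    signedIntegral (Function.update φ i fun x => g x - ∑ k, c k * h k x) =
      signedIntegral (Function.update φ i g) -
        ∑ k, c k * signedIntegral (Function.update φ i (h k)) := by
  have h2 : ∀ k ∈ Finset.univ, Integrable fun x : Fin n → ℝ =>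
      c k * ((∏ j, Function.update φ i (h k) j (x j)) * vandermondeSign x) :=
    fun k _ => (integrable_signed (integrable_update hφ i (hh k))).const_mul _
  unfold signedIntegral
  simp only [← integral_const_mul]
  rw [← integral_finsetSum _ h2,
    ← integral_sub (integrable_signed (integrable_update hφ i hg)) (integrable_finsetSum _ h2)]
  congr 1
  ext x
  simp only [prod_update_apply]
  rw [sub_mul, sub_mul, Finset.sum_mul, Finset.sum_mul]
  simp only [mul_assoc]

theorem signedIntegral_swap {n : ℕ} (φ : Fin n → ℝ → ℝ) {i j : Fin n} (hij : i ≠ j) :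
    signedIntegral (φ ∘ Equiv.swap i j) = -signedIntegral φ := by
  rw [signedIntegral_comp_perm, Equiv.Perm.sign_swap hij]
  simp

theorem signedIntegral_eq_zero {n : ℕ} {φ : Fin n → ℝ → ℝ} {i j : Fin n} (hij : i ≠ j)
    (h : φ i = φ j) : signedIntegral φ = 0 := by
  have hs : φ ∘ Equiv.swap i j = φ := by
    funext k
    rcases eq_or_ne k i with rfl | hi
    · simp [h]
    · rcases eq_or_ne k j with rfl | hj
      · simp [h]
      · simp [Equiv.swap_apply_of_ne_of_ne hi hj]
  have := signedIntegral_swap φ hij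
  rw [hs] at this
  linarith

/-- The Gram matrix of the skew form. -/
def skewGram {n : ℕ} (φ : Fin n → ℝ → ℝ) : Matrix (Fin n) (Fin n) ℝ :=
  Matrix.of fun j l => skewForm n (φ j) (φ l)

theorem skewGram_transpose {n : ℕ} {φ : Fin n → ℝ → ℝ} (hφ : ∀ j, Integrable (φ j)) :
    (skewGram φ).transpose = -skewGram φ := by
  ext j l
  simp only [skewGram, Matrix.transpose_apply, Matrix.of_apply, Matrix.neg_apply]
  exact skewForm_swap n (hφ j) (hφ l)

/-- The coordinates of the skew projection of `g` to the span of `φ`. -/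
def skewCoord {n : ℕ} (φ : Fin n → ℝ → ℝ) (g : ℝ → ℝ) (i : Fin n) : ℝ :=
  ∑ k, skewForm n g (φ k) * (skewGram φ)⁻¹ k i

/-! ### Inverse of the skew Gram matrix from the row expansion -/

section Nondegenerate

variable {n : ℕ} {φ : Fin n → ℝ → ℝ}

/-- The cofactors along row `i` do not see the function in slot `i`. Putting `φ j` there gives the
full integral if `j = i`, and zero otherwise because two slots agree; so the normalized cofactors
are a right inverse of the Gram matrix. In the last clause skew-orthogonality kills every term of
the expansion except `k = j`, whose cofactor sees neither changed slot. -/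
theorem exists_row_expansion (hn : Even n) (hφ : ∀ j, Integrable (φ j))
    (hF : signedIntegral φ ≠ 0) :
    IsUnit (skewGram φ).det ∧
      (∀ i g, Integrable g →
        signedIntegral (Function.update φ i g) = signedIntegral φ * skewCoord φ g i) ∧
      ∀ i j, i ≠ j → ∀ g g', Integrable g → Integrable g' →
        (∀ k, skewForm n g (φ k) = 0) →
        signedIntegral (Function.update (Function.update φ j g') i g) =
          signedIntegral φ * (skewForm n g g' * (skewGram φ)⁻¹ j i) := by
  classical
  choose G hG hexp using fun i : Fin n => exists_signedIntegral_eq_sum hn i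
  let C : Matrix (Fin n) (Fin n) ℝ :=
    Matrix.of fun k i => if k = i then 0 else G i k φ / signedIntegral φ
  have hrow : ∀ i g, Integrable g → signedIntegral (Function.update φ i g) =
      signedIntegral φ * ∑ k, skewForm n g (φ k) * C k i := by
    intro i g hg
    rw [hexp i _ (integrable_update hφ i hg), Finset.mul_sum,
      ← Finset.add_sum_erase _ _ (Finset.mem_univ i)]
    simp only [C, Matrix.of_apply, if_true, mul_zero, zero_add, Function.update_self]
    refine Finset.sum_congr rfl fun k hk => ?_
    have hki := Finset.ne_of_mem_erase hk
    rw [Function.update_of_ne hki, if_neg hki,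
      hG i k _ φ fun j hj _ => Function.update_of_ne hj _ _]
    field_simp
  have hMC : skewGram φ * C = 1 := by
    ext j i
    have h := hrow i (φ j) (hφ j)
    have hsum : (skewGram φ * C) j i = ∑ k, skewForm n (φ j) (φ k) * C k i := by
      simp [Matrix.mul_apply, skewGram]
    rw [hsum]
    rcases eq_or_ne j i with rfl | hji
    · rw [Function.update_eq_self] at h
      rw [Matrix.one_apply_eq]
      exact mul_left_cancel₀ hF (by rw [← h, mul_one])
    · rw [signedIntegral_eq_zero hji (by
        rw [Function.update_self, Function.update_of_ne hji])] at h
      rw [Matrix.one_apply_ne hji]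
      exact (mul_eq_zero.1 h.symm).resolve_left hF
  have hinv : (skewGram φ)⁻¹ = C := Matrix.inv_eq_right_inv hMC
  refine ⟨Matrix.isUnit_det_of_right_inverse hMC, ?_, ?_⟩
  · intro i g hg
    rw [hrow i g hg, skewCoord, hinv]
  · intro i j hij g g' hg hg' hz
    rw [hexp i _ (integrable_update (integrable_update hφ j hg') i hg),
      Finset.sum_eq_single_of_mem j (Finset.mem_erase.2 ⟨hij.symm, Finset.mem_univ _⟩)]
    · rw [Function.update_self, Function.update_of_ne hij.symm, Function.update_self,
        hG i j _ φ fun k hki hkj => by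
          rw [Function.update_of_ne hki, Function.update_of_ne hkj], hinv]
      simp only [C, Matrix.of_apply, if_neg hij.symm]
      field_simp
    · intro k hk hkj
      rw [Function.update_self, Function.update_of_ne (Finset.ne_of_mem_erase hk),
        Function.update_of_ne hkj, hz, zero_mul]

theorem skewGram_inv_swap (hφ : ∀ j, Integrable (φ j)) (i j : Fin n) :
    (skewGram φ)⁻¹ j i = -(skewGram φ)⁻¹ i j := by
  have h : ((skewGram φ)⁻¹).transpose = -(skewGram φ)⁻¹ := by
    rw [Matrix.transpose_nonsing_inv, skewGram_transpose hφ]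
    by_cases hu : IsUnit (skewGram φ).det
    · refine Matrix.inv_eq_right_inv ?_
      rw [neg_mul_neg, Matrix.mul_nonsing_inv _ hu]
    -- In the singular case both inverses have the default value `0`.
    · have hu' : ¬IsUnit (-skewGram φ).det := by
        rw [← skewGram_transpose hφ, Matrix.det_transpose]; exact hu
      rw [Matrix.nonsing_inv_apply_not_isUnit _ hu, Matrix.nonsing_inv_apply_not_isUnit _ hu',
        neg_zero]
  have := congrFun (congrFun h i) j
  simpa using this

/-- Subtract from `g` its skew projection onto the span of `φ`. The remainder is skew-orthogonal to
every `φ k`, so the last clause of `exists_row_expansion` applies and gives the term with `(skewGram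
φ)⁻¹ j i`; the projection gives the two products of coordinates. -/
theorem signedIntegral_update_update (hn : Even n) (hφ : ∀ j, Integrable (φ j))
    (hF : signedIntegral φ ≠ 0) {i j : Fin n} (hij : i ≠ j) {g g' : ℝ → ℝ} (hg : Integrable g)
    (hg' : Integrable g') :
    signedIntegral (Function.update (Function.update φ j g') i g) =
      signedIntegral φ * (skewCoord φ g i * skewCoord φ g' j - skewCoord φ g j * skewCoord φ g' i +
        (skewForm n g g' - ∑ k, skewCoord φ g k * skewForm n (φ k) g') * (skewGram φ)⁻¹ j i) := by
  obtain ⟨hu, hone, htwo⟩ := exists_row_expansion hn hφ hF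
  have hz : ∀ l, skewForm n (fun x => g x - ∑ k, skewCoord φ g k * φ k x) (φ l) = 0 := by
    intro l
    rw [skewForm_sub_sum n hg hφ (hφ l), sub_eq_zero]
    have h1 : ∀ m, ∑ k, (skewGram φ)⁻¹ m k * skewForm n (φ k) (φ l) = if m = l then 1 else 0 := by
      intro m
      have := congrFun (congrFun (Matrix.nonsing_inv_mul (skewGram φ) hu) m) l
      rwa [Matrix.mul_apply, Matrix.one_apply] at this
    simp only [skewCoord, Finset.sum_mul]
    rw [Finset.sum_comm]
    simp only [mul_assoc, ← Finset.mul_sum, h1]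
    simp
  -- With `φ k` in slot `i`, only two cases survive: `k = i` restores the original slot, and `k = j`
  -- is a transposition of `φ` with `g'` in slot `i`, whence the minus sign. For any other `k` the
  -- function `φ k` occurs twice.
  have hterm : ∀ k, signedIntegral (Function.update (Function.update φ j g') i (φ k)) =
      signedIntegral φ * ((if k = i then skewCoord φ g' j else 0) -
        if k = j then skewCoord φ g' i else 0) := by
    intro k
    rcases eq_or_ne k i with rfl | hki
    · have : Function.update (Function.update φ j g') k (φ k) = Function.update φ j g' := by
        rw [Function.update_eq_self_iff, Function.update_of_ne hij]
      rw [this, hone j g' hg', if_pos rfl, if_neg hij, sub_zero]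
    · rcases eq_or_ne k j with rfl | hkj
      · have : Function.update (Function.update φ k g') i (φ k) =
            Function.update φ i g' ∘ Equiv.swap i k := by
          funext l
          rcases eq_or_ne l i with rfl | hli
          · simp [Function.update_of_ne hki]
          · rcases eq_or_ne l k with rfl | hlk
            · simp [Function.update_of_ne hli]
            · simp [Function.update_of_ne, hli, hlk, Equiv.swap_apply_of_ne_of_ne]
        rw [this, signedIntegral_swap _ hij, hone i g' hg', if_neg hki, if_pos rfl]
        ring
      · rw [signedIntegral_eq_zero (Ne.symm hki) (by
          rw [Function.update_self, Function.update_of_ne hki, Function.update_of_ne hkj]),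
          if_neg hki, if_neg hkj]
        ring
  have h1 := htwo i j hij _ g' (integrable_sub_sum hg hφ (skewCoord φ g)) hg' hz
  rw [signedIntegral_update_sub_sum (integrable_update hφ j hg') i hg hφ,
    skewForm_sub_sum n hg hφ hg'] at h1
  have h2 : ∑ k, skewCoord φ g k *
      signedIntegral (Function.update (Function.update φ j g') i (φ k)) =
        signedIntegral φ * (skewCoord φ g i * skewCoord φ g' j -
          skewCoord φ g j * skewCoord φ g' i) := by
    simp only [hterm, mul_sub, mul_ite, mul_zero, Finset.sum_sub_distrib, Finset.sum_ite_eq',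
      Finset.mem_univ, if_true]
    ring
  rw [h2] at h1
  linear_combination h1

end Nondegenerate

/-! ### Orthogonal polynomials -/

theorem monicOrthPoly_monic_degree (w : ℝ → ℝ) (l : ℕ) :
    (monicOrthPoly w l).Monic ∧ (monicOrthPoly w l).natDegree = l := by
  induction l using Nat.strong_induction_on with
  | _ l ih =>
    have hlt : (∑ k : Fin l, C ((∫ x, x ^ l * (monicOrthPoly w k).eval x * w x) /
        ∫ x, (monicOrthPoly w k).eval x ^ 2 * w x) * monicOrthPoly w k).degree < (l : ℕ) := by
      rw [← Polynomial.mem_degreeLT]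
      refine Submodule.sum_mem _ fun k _ => ?_
      rw [← Polynomial.smul_eq_C_mul]
      refine Submodule.smul_mem _ _ (Polynomial.mem_degreeLT.2 ?_)
      rw [Polynomial.degree_eq_natDegree (ih k k.2).1.ne_zero, (ih k k.2).2]
      exact_mod_cast k.2
    rw [monicOrthPoly]
    have hlt' := hlt
    rw [← Polynomial.degree_X_pow (R := ℝ) l] at hlt'
    refine ⟨(Polynomial.monic_X_pow l).sub_of_left hlt', ?_⟩
    exact Polynomial.natDegree_eq_of_degree_eq_some
      ((Polynomial.degree_sub_eq_left_of_degree_lt hlt').trans (Polynomial.degree_X_pow l))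

theorem exists_abs_eval_le (p : ℝ[X]) :
    ∃ C, 0 ≤ C ∧ ∀ x : ℝ, |p.eval x| ≤ C * (1 + |x|) ^ p.natDegree := by
  refine ⟨∑ i ∈ Finset.range (p.natDegree + 1), |p.coeff i|,
    Finset.sum_nonneg fun _ _ => abs_nonneg _, fun x => ?_⟩
  rw [Polynomial.eval_eq_sum_range, Finset.sum_mul]
  refine (Finset.abs_sum_le_sum_abs _ _).trans (Finset.sum_le_sum fun i hi => ?_)
  rw [abs_mul, abs_pow]
  refine mul_le_mul_of_nonneg_left ?_ (abs_nonneg _)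
  calc |x| ^ i ≤ (1 + |x|) ^ i := by gcongr; linarith
    _ ≤ (1 + |x|) ^ p.natDegree :=
      pow_le_pow_right₀ (by linarith [abs_nonneg x]) (by simpa [Nat.lt_succ_iff] using hi)

/-! ### Decay and normalization of the weighted polynomials -/

section Weight

variable {n : ℕ} {V : ℝ → ℝ} {δ : ℝ}

theorem sqrt_weight (n : ℕ) (V : ℝ → ℝ) (x : ℝ) :
    Real.sqrt (weight n V x) = Real.exp (-((n : ℝ) / 2) * V x) := by
  rw [weight, Real.sqrt_eq_iff_mul_self_eq (Real.exp_pos _).le (Real.exp_pos _).le, ← Real.exp_add]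
  congr 1
  ring

theorem continuous_sqrt_weight_mul_eval (hV : Continuous V) (p : ℝ[X]) :
    Continuous fun x => Real.sqrt (weight n V x) * p.eval x := by
  simp only [sqrt_weight]
  exact (Real.continuous_exp.comp (continuous_const.mul hV)).mul p.continuous

/-- The growth condition gives `w^(1/2) ≤ (1 + |x|)^(-n(1+δ))`, while the polynomial grows at most
like the power `n - 1`. The resulting exponent `-(1 + nδ)` is below `-1`, hence integrable. -/
theorem exists_sqrt_weight_mul_eval_le (hn : 0 < n)
    (hg : ∀ x, 2 * (1 + δ) * Real.log (1 + |x|) ≤ V x) {p : ℝ[X]} (hp : p.natDegree < n) :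
    ∃ C, 0 ≤ C ∧ ∀ x, |Real.sqrt (weight n V x) * p.eval x| ≤
      C * (1 + |x|) ^ (-(1 + n * δ) : ℝ) := by
  obtain ⟨C, hC, hb⟩ := exists_abs_eval_le p
  refine ⟨C, hC, fun x => ?_⟩
  have hx : 0 < 1 + |x| := by positivity
  have hw : Real.sqrt (weight n V x) ≤ (1 + |x|) ^ (-(n * (1 + δ)) : ℝ) := by
    rw [sqrt_weight, Real.rpow_def_of_pos hx]
    refine Real.exp_le_exp.2 ?_
    have h := mul_le_mul_of_nonneg_left (hg x) (by positivity : (0 : ℝ) ≤ n / 2)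
    linarith
  have hp' : (1 + |x|) ^ p.natDegree ≤ (1 + |x|) ^ ((n : ℝ) - 1) := by
    rw [← Real.rpow_natCast]
    refine Real.rpow_le_rpow_of_exponent_le (by linarith [abs_nonneg x]) ?_
    have : p.natDegree + 1 ≤ n := hp
    have : ((p.natDegree + 1 : ℕ) : ℝ) ≤ n := by exact_mod_cast this
    push_cast at this
    linarith
  rw [abs_mul, abs_of_nonneg (Real.sqrt_nonneg _)]
  calc _ ≤ (1 + |x|) ^ (-(n * (1 + δ)) : ℝ) * (C * (1 + |x|) ^ ((n : ℝ) - 1)) :=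
        mul_le_mul hw ((hb x).trans (by gcongr)) (abs_nonneg _) (by positivity)
    _ = C * ((1 + |x|) ^ (-(n * (1 + δ)) : ℝ) * (1 + |x|) ^ ((n : ℝ) - 1)) := by ring
    _ = _ := by rw [← Real.rpow_add hx]; congr 2; ring

theorem integrable_sqrt_weight_mul_eval (hn : 0 < n) (hV : Continuous V) (hδ : 0 < δ)
    (hg : ∀ x, 2 * (1 + δ) * Real.log (1 + |x|) ≤ V x) {p : ℝ[X]} (hp : p.natDegree < n) :
    Integrable fun x => Real.sqrt (weight n V x) * p.eval x := by
  obtain ⟨C, -, hb⟩ := exists_sqrt_weight_mul_eval_le hn hg hp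
  have hn' : (0 : ℝ) < n := by exact_mod_cast hn
  have h1 : Integrable fun x : ℝ => (1 + ‖x‖) ^ (-(1 + n * δ) : ℝ) :=
    integrable_one_add_norm (by simp; positivity)
  exact (h1.const_mul C).mono' (continuous_sqrt_weight_mul_eval hV p).aestronglyMeasurable
    (Filter.Eventually.of_forall hb)

/-- Ensures that the normalization divides by a nonzero norm: the integrand is continuous,
nonnegative and integrable, and it vanishes identically only if the polynomial does. -/
theorem integral_monicOrthPoly_sq_pos (hn : 0 < n) (hV : Continuous V) (hδ : 0 < δ)
    (hg : ∀ x, 2 * (1 + δ) * Real.log (1 + |x|) ≤ V x) {l : ℕ} (hl : l < n) :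
    0 < ∫ x, (monicOrthPoly (weight n V) l).eval x ^ 2 * weight n V x := by
  obtain ⟨hm, hd⟩ := monicOrthPoly_monic_degree (weight n V) l
  set p := monicOrthPoly (weight n V) l
  have hp : p.natDegree < n := by rw [hd]; exact hl
  have hc := continuous_sqrt_weight_mul_eval (n := n) hV p
  have heq : (fun x => p.eval x ^ 2 * weight n V x) =
      fun x => (Real.sqrt (weight n V x) * p.eval x) * (Real.sqrt (weight n V x) * p.eval x) := by
    funext x
    have : Real.sqrt (weight n V x) * Real.sqrt (weight n V x) = weight n V x :=
      Real.mul_self_sqrt (Real.exp_pos _).le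
    linear_combination (-(p.eval x) ^ 2) * this
  obtain ⟨C, hC, hb⟩ := exists_sqrt_weight_mul_eval_le hn hg hp
  have hi : Integrable fun x => p.eval x ^ 2 * weight n V x := by
    rw [heq]
    refine (integrable_sqrt_weight_mul_eval hn hV hδ hg hp).mul_bdd (c := C)
      hc.aestronglyMeasurable (Filter.Eventually.of_forall fun x => (hb x).trans ?_)
    refine mul_le_of_le_one_right hC (Real.rpow_le_one_of_one_le_of_nonpos ?_ ?_)
    · linarith [abs_nonneg x]
    · have : 0 ≤ (n : ℝ) * δ := by positivity
      linarith
  have hnn : ∀ x, 0 ≤ p.eval x ^ 2 * weight n V x :=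
    fun x => mul_nonneg (sq_nonneg _) (Real.exp_pos _).le
  rw [integral_pos_iff_support_of_nonneg hnn hi]
  refine IsOpen.measure_pos _ ?_ ?_
  · rw [heq]
    exact (hc.mul hc).isOpen_support
  · by_contra hne
    rw [Set.not_nonempty_iff_eq_empty, Function.support_eq_empty_iff] at hne
    refine hm.ne_zero (Polynomial.funext fun x => ?_)
    have h := congrFun hne x
    simp only [Pi.zero_apply, mul_eq_zero, weight, (Real.exp_pos _).ne', or_false] at h
    simpa using h

theorem psi_eq (n : ℕ) (V : ℝ → ℝ) (l : ℕ) (x : ℝ) :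
    psi n V l x = (Real.sqrt (∫ x, (monicOrthPoly (weight n V) l).eval x ^ 2 * weight n V x))⁻¹ *
      (Real.sqrt (weight n V x) * (monicOrthPoly (weight n V) l).eval x) := by
  simp only [psi, orthPoly, eval_mul, eval_C]
  ring

theorem continuous_psi (hV : Continuous V) (l : ℕ) : Continuous (psi n V l) := by
  have : psi n V l = _ := funext (psi_eq n V l)
  rw [this]
  exact continuous_const.mul (continuous_sqrt_weight_mul_eval hV _)

theorem integrable_psi (hn : 0 < n) (hV : Continuous V) (hδ : 0 < δ)
    (hg : ∀ x, 2 * (1 + δ) * Real.log (1 + |x|) ≤ V x) {l : ℕ} (hl : l < n) :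
    Integrable (psi n V l) := by
  have : psi n V l = _ := funext (psi_eq n V l)
  rw [this]
  refine (integrable_sqrt_weight_mul_eval hn hV hδ hg ?_).const_mul _
  rw [(monicOrthPoly_monic_degree _ _).2]
  exact hl

/-! ### The joint density -/

/-- A determinant of monic polynomials of degrees `0, …, n - 1` is the Vandermonde determinant, and
multiplying it by its sign gives the absolute value. The constant `κ` is the product of the norms.
-/
theorem exists_jointWeight_eq (hn : 0 < n) (hV : Continuous V) (hδ : 0 < δ)
    (hg : ∀ x, 2 * (1 + δ) * Real.log (1 + |x|) ≤ V x) :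
    ∃ κ : ℝ, κ ≠ 0 ∧ ∀ x : Fin n → ℝ, jointWeight n V x =
      κ * ((Matrix.of fun i j : Fin n => psi n V j (x i)).det * vandermondeSign x) := by
  let N (l : ℕ) : ℝ := Real.sqrt (∫ x, (monicOrthPoly (weight n V) l).eval x ^ 2 * weight n V x)
  have hN : ∀ l : Fin n, N l ≠ 0 := fun l =>
    (Real.sqrt_pos.2 (integral_monicOrthPoly_sq_pos hn hV hδ hg l.2)).ne'
  refine ⟨∏ l : Fin n, N l, Finset.prod_ne_zero_iff.2 fun l _ => hN l, fun x => ?_⟩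
  have hdet : (Matrix.of fun i j : Fin n => psi n V j (x i)).det =
      (∏ j : Fin n, (N j)⁻¹) * ((∏ i, Real.sqrt (weight n V (x i))) *
        (Matrix.vandermonde x).det) := by
    rw [Matrix.det_eval_matrixOfPolynomials_eq_det_vandermonde x
      (fun l => monicOrthPoly (weight n V) l) (fun l => (monicOrthPoly_monic_degree _ _).2)
      (fun l => (monicOrthPoly_monic_degree _ _).1), ← Matrix.det_mul_column,
      ← Matrix.det_mul_row]
    congr 1
    ext i j
    simp only [Matrix.of_apply]
    exact psi_eq n V j (x i)
  have habs : ∏ j : Fin n, ∏ k ∈ Finset.Ioi j, |x j - x k| =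
      (Matrix.vandermonde x).det * vandermondeSign x := by
    rw [vandermondeSign_eq_sign_det, mul_sign_self, Matrix.det_vandermonde, Finset.abs_prod]
    refine Finset.prod_congr rfl fun j _ => ?_
    rw [Finset.abs_prod]
    exact Finset.prod_congr rfl fun k _ => abs_sub_comm _ _
  have hcancel : (∏ l : Fin n, N l) * ∏ l : Fin n, (N l)⁻¹ = 1 := by
    rw [← Finset.prod_mul_distrib]
    exact Finset.prod_eq_one fun l _ => mul_inv_cancel₀ (hN l)
  rw [jointWeight, habs, hdet, Finset.mul_sum, Real.exp_sum]
  simp only [sqrt_weight]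
  linear_combination (-(∏ i, Real.exp (-((n : ℝ) / 2) * V (x i))) *
    ((Matrix.vandermonde x).det * vandermondeSign x)) * hcancel

theorem continuous_jointWeight (hV : Continuous V) : Continuous (jointWeight n V) := by
  unfold jointWeight
  fun_prop

theorem jointWeight_nonneg (x : Fin n → ℝ) : 0 ≤ jointWeight n V x :=
  mul_nonneg (Real.exp_pos _).le (Finset.prod_nonneg fun _ _ => Finset.prod_nonneg fun _ _ =>
    abs_nonneg _)

end Weight

/-! ### Symmetrization of the determinant -/

theorem integral_comp_perm {n : ℕ} (π : Equiv.Perm (Fin n)) (f : (Fin n → ℝ) → ℝ) :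
    ∫ x : Fin n → ℝ, f (x ∘ π) = ∫ x, f x := by
  rw [← (volume_measurePreserving_piCongrLeft (fun _ : Fin n => ℝ) π.symm).integral_comp' (g := f)]
  simp only [piCongrLeft_eq_comp, Equiv.symm_symm]

/-- In the Leibniz expansion, the sign of each permutation is absorbed by the Vandermonde sign, so
all `n!` terms are relabelings of the diagonal one and have the same integral. -/
theorem integral_mul_det_mul_sign {n : ℕ} {φ : Fin n → ℝ → ℝ} (hφ : ∀ j, Integrable (φ j))
    {h : (Fin n → ℝ) → ℝ} (hm : Measurable h) {K : ℝ} (hK : ∀ x, |h x| ≤ K)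
    (hsymm : ∀ (π : Equiv.Perm (Fin n)) x, h (x ∘ π) = h x) :
    (Integrable fun x : Fin n → ℝ =>
      h x * ((Matrix.of fun i j : Fin n => φ j (x i)).det * vandermondeSign x)) ∧
    ∫ x : Fin n → ℝ, h x * ((Matrix.of fun i j : Fin n => φ j (x i)).det * vandermondeSign x) =
      n.factorial * ∫ x : Fin n → ℝ, h x * ((∏ j, φ j (x j)) * vandermondeSign x) := by
  have hexp : ∀ x : Fin n → ℝ,
      h x * ((Matrix.of fun i j : Fin n => φ j (x i)).det * vandermondeSign x) =
        ∑ π : Equiv.Perm (Fin n),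
          (fun y => h y * ((∏ j, φ j (y j)) * vandermondeSign y)) (x ∘ π) := by
    intro x
    rw [Matrix.det_apply', Finset.sum_mul, Finset.mul_sum]
    refine Finset.sum_congr rfl fun π _ => ?_
    simp only [hsymm, vandermondeSign_perm, Matrix.of_apply, Function.comp_apply]
    ring
  have hint : Integrable fun y : Fin n → ℝ => h y * ((∏ j, φ j (y j)) * vandermondeSign y) :=
    (integrable_signed hφ).bdd_mul (c := K) hm.aestronglyMeasurable
      (Filter.Eventually.of_forall hK)
  have hint' : ∀ π ∈ (Finset.univ : Finset (Equiv.Perm (Fin n))), Integrable fun x : Fin n → ℝ =>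
      (fun y => h y * ((∏ j, φ j (y j)) * vandermondeSign y)) (x ∘ π) := by
    intro π _
    have := ((volume_measurePreserving_piCongrLeft (fun _ : Fin n => ℝ) π.symm).integrable_comp_emb
      (MeasurableEquiv.measurableEmbedding _)).2 hint
    refine this.congr (Filter.Eventually.of_forall fun x => ?_)
    rw [Function.comp_apply, piCongrLeft_eq_comp, Equiv.symm_symm]
  simp only [hexp]
  refine ⟨integrable_finsetSum _ hint', ?_⟩
  rw [integral_finsetSum _ hint']
  simp only [integral_comp_perm _ fun y => h y * ((∏ j, φ j (y j)) * vandermondeSign y)]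
  rw [Finset.sum_const, Finset.card_univ, Fintype.card_perm, Fintype.card_fin, nsmul_eq_mul]

/-! ### The operator `ε` -/

theorem abs_epsOp_le (f : ℝ → ℝ) (hf : Integrable f) (x : ℝ) :
    |epsOp f x| ≤ 1 / 2 * ∫ y, |f y| := by
  rw [epsOp, ← integral_const_mul]
  refine abs_integral_le_integral_abs.trans (integral_mono_of_nonneg
    (Filter.Eventually.of_forall fun _ => abs_nonneg _) (hf.abs.const_mul _)
    (Filter.Eventually.of_forall fun y => ?_))
  beta_reduce
  rw [abs_mul]
  exact mul_le_mul_of_nonneg_right (abs_eps_le _) (abs_nonneg _)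

/-- Off the diagonal, `eps (x - y)` is the indicator of `y ≤ x` minus `1 / 2`; so `epsOp f` is an
antiderivative of `f`. -/
theorem epsOp_eq {f : ℝ → ℝ} (hf : Integrable f) (x : ℝ) :
    epsOp f x = (∫ y in Set.Iic x, f y) - 1 / 2 * ∫ y, f y := by
  rw [← integral_indicator measurableSet_Iic, ← integral_const_mul,
    ← integral_sub (hf.indicator measurableSet_Iic) (hf.const_mul _), epsOp]
  refine integral_congr_ae ?_
  filter_upwards [Measure.ae_ne volume x] with y hy
  rcases lt_or_gt_of_ne hy with h | h
  · rw [eps, Real.sign_of_pos (by linarith), Set.indicator_of_mem (Set.mem_Iic.2 h.le)]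
    ring
  · rw [eps, Real.sign_of_neg (by linarith), Set.indicator_of_notMem (by simpa using h)]
    ring

theorem hasDerivAt_epsOp {f : ℝ → ℝ} (hf : Integrable f) (hc : Continuous f) (x : ℝ) :
    HasDerivAt (epsOp f) (f x) x := by
  have h : epsOp f = fun x => (∫ y in (0 : ℝ)..x, f y) +
      ((∫ y in Set.Iic 0, f y) - 1 / 2 * ∫ y, f y) := by
    funext x
    rw [epsOp_eq hf, ← intervalIntegral.integral_Iic_sub_Iic hf.integrableOn hf.integrableOn]
    ring
  rw [h]
  exact (intervalIntegral.integral_hasDerivAt_right (hc.intervalIntegrable _ _)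
    (hc.stronglyMeasurableAtFilter _ _) hc.continuousAt).add_const _

theorem continuous_epsOp {f : ℝ → ℝ} (hf : Integrable f) (hc : Continuous f) :
    Continuous (epsOp f) :=
  continuous_iff_continuousAt.2 fun x => (hasDerivAt_epsOp hf hc x).continuousAt

theorem integrable_eps_mul {f : ℝ → ℝ} (hf : Integrable f) (x : ℝ) :
    Integrable fun y => eps (x - y) * f y :=
  hf.bdd_mul (c := 1 / 2)
    (measurable_eps.comp (measurable_const.sub measurable_id)).aestronglyMeasurable
    (Filter.Eventually.of_forall fun y => abs_eps_le (x - y))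

/-! ### The two-point cluster function -/

section Cluster

variable {n : ℕ}

/-- The scalar entry of the matrix kernel, up to sign. -/
def scalarKernel (φ : Fin n → ℝ → ℝ) (x y : ℝ) : ℝ :=
  ∑ p : Fin n × Fin n, φ p.1 x * (skewGram φ)⁻¹ p.1 p.2 * (n * epsOp (φ p.2) y)

/-- The derivative entry of the matrix kernel. -/
def derivKernel (φ : Fin n → ℝ → ℝ) (x y : ℝ) : ℝ :=
  ∑ p : Fin n × Fin n, φ p.1 x * (skewGram φ)⁻¹ p.1 p.2 * (n * φ p.2 y)

/-- The integrated entry of the matrix kernel, up to sign. -/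
def integralKernel (φ : Fin n → ℝ → ℝ) (x y : ℝ) : ℝ :=
  ∑ p : Fin n × Fin n, epsOp (φ p.1) x * (skewGram φ)⁻¹ p.1 p.2 * (n * epsOp (φ p.2) y)

/-- The two-point cluster function. -/
def clusterFunction (φ : Fin n → ℝ → ℝ) (x y : ℝ) : ℝ :=
  scalarKernel φ x y * scalarKernel φ y x +
    derivKernel φ x y * (integralKernel φ x y + eps (x - y))

/-- Each summand is a function of `x` times a function of `y`, except those carrying `eps (x - y)`,
whose integrals are skew forms. -/
theorem mul_clusterFunction (φ : Fin n → ℝ → ℝ) (f g : ℝ → ℝ) (x y : ℝ) :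
    f x * g y * clusterFunction φ x y =
      (∑ p : Fin n × Fin n, ∑ q : Fin n × Fin n,
        (skewGram φ)⁻¹ p.1 p.2 * (skewGram φ)⁻¹ q.1 q.2 *
          ((f x * φ p.1 x * (n * epsOp (φ q.2) x)) * (g y * φ q.1 y * (n * epsOp (φ p.2) y)))) +
      (∑ p : Fin n × Fin n, ∑ q : Fin n × Fin n,
        (skewGram φ)⁻¹ p.1 p.2 * (skewGram φ)⁻¹ q.1 q.2 *
          ((f x * φ p.1 x * (n * epsOp (φ q.1) x)) * (g y * φ p.2 y * (n * epsOp (φ q.2) y)))) +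
      ∑ p : Fin n × Fin n, (skewGram φ)⁻¹ p.1 p.2 *
        (n * ((f x * φ p.1 x) * (g y * φ p.2 y) * eps (x - y))) := by
  unfold clusterFunction scalarKernel derivKernel integralKernel
  rw [mul_add, mul_add, mul_add, ← add_assoc, Finset.sum_mul_sum, Finset.sum_mul_sum]
  simp only [Finset.mul_sum, Finset.sum_mul]
  congr 1
  · congr 1
    · exact Finset.sum_congr rfl fun p _ => Finset.sum_congr rfl fun q _ => by ring
    · exact Finset.sum_congr rfl fun p _ => Finset.sum_congr rfl fun q _ => by ring
  · exact Finset.sum_congr rfl fun p _ => by ring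

variable {φ : Fin n → ℝ → ℝ} {f g : ℝ → ℝ} {K : ℝ}

theorem integrable_bdd_mul (hφ : ∀ j, Integrable (φ j)) (hf : Measurable f) (hK : ∀ x, |f x| ≤ K)
    (i : Fin n) : Integrable fun x => f x * φ i x :=
  (hφ i).bdd_mul (c := K) hf.aestronglyMeasurable (Filter.Eventually.of_forall hK)

theorem integrable_bdd_mul_epsOp (hφ : ∀ j, Integrable (φ j)) (hc : ∀ j, Continuous (φ j))
    (hf : Measurable f) (hK : ∀ x, |f x| ≤ K) (i k : Fin n) :
    Integrable fun x => f x * φ i x * (n * epsOp (φ k) x) := by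
  refine (integrable_bdd_mul hφ hf hK i).mul_bdd (c := n * (1 / 2 * ∫ y, |φ k y|))
    (continuous_const.mul (continuous_epsOp (hφ k) (hc k))).aestronglyMeasurable
    (Filter.Eventually.of_forall fun x => ?_)
  rw [Real.norm_eq_abs, abs_mul, Nat.abs_cast]
  exact mul_le_mul_of_nonneg_left (abs_epsOp_le _ (hφ k) x) (Nat.cast_nonneg n)

theorem integral_bdd_mul_epsOp (i k : Fin n) :
    ∫ x, f x * φ i x * (n * epsOp (φ k) x) = skewForm n (fun x => f x * φ i x) (φ k) := by
  rw [skewForm, ← integral_const_mul]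
  congr 1
  ext x
  ring

theorem integrable_mul_clusterFunction (hφ : ∀ j, Integrable (φ j)) (hc : ∀ j, Continuous (φ j))
    (hf : Measurable f) (hfK : ∀ x, |f x| ≤ K) (hg : Measurable g) (hgK : ∀ x, |g x| ≤ K) :
    Integrable fun z : ℝ × ℝ => f z.1 * g z.2 * clusterFunction φ z.1 z.2 := by
  simp only [mul_clusterFunction]
  refine ((integrable_finsetSum _ fun p _ => integrable_finsetSum _ fun q _ => ?_).add
    (integrable_finsetSum _ fun p _ => integrable_finsetSum _ fun q _ => ?_)).add
    (integrable_finsetSum _ fun p _ => ?_)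
  · exact ((integrable_bdd_mul_epsOp hφ hc hf hfK _ _).mul_prod
      (integrable_bdd_mul_epsOp hφ hc hg hgK _ _)).const_mul _
  · exact ((integrable_bdd_mul_epsOp hφ hc hf hfK _ _).mul_prod
      (integrable_bdd_mul_epsOp hφ hc hg hgK _ _)).const_mul _
  · exact ((integrable_mul_mul_eps (integrable_bdd_mul hφ hf hfK _)
      (integrable_bdd_mul hφ hg hgK _)).const_mul _).const_mul _

theorem integral_double_sums_add {α ι : Type*} [MeasurableSpace α] {μ : Measure α} [Fintype ι]
    (c d : ι → ι → ℝ) (e : ι → ℝ) {F G : ι → ι → α → ℝ} {H : ι → α → ℝ}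
    (hF : ∀ p q, Integrable (F p q) μ) (hG : ∀ p q, Integrable (G p q) μ)
    (hH : ∀ p, Integrable (H p) μ) :
    ∫ z, (∑ p, ∑ q, c p q * F p q z) + (∑ p, ∑ q, d p q * G p q z) + ∑ p, e p * H p z ∂μ =
      (∑ p, ∑ q, c p q * ∫ z, F p q z ∂μ) + (∑ p, ∑ q, d p q * ∫ z, G p q z ∂μ) +
        ∑ p, e p * ∫ z, H p z ∂μ := by
  have hF' : ∀ p, Integrable (fun z => ∑ q, c p q * F p q z) μ :=
    fun p => integrable_finsetSum _ fun q _ => (hF p q).const_mul _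
  have hG' : ∀ p, Integrable (fun z => ∑ q, d p q * G p q z) μ :=
    fun p => integrable_finsetSum _ fun q _ => (hG p q).const_mul _
  have hF'' : Integrable (fun z => ∑ p, ∑ q, c p q * F p q z) μ :=
    integrable_finsetSum _ fun p _ => hF' p
  have hG'' : Integrable (fun z => ∑ p, ∑ q, d p q * G p q z) μ :=
    integrable_finsetSum _ fun p _ => hG' p
  have hFG : Integrable (fun z => (∑ p, ∑ q, c p q * F p q z) + ∑ p, ∑ q, d p q * G p q z) μ :=
    hF''.add hG''
  rw [integral_add hFG (integrable_finsetSum _ fun p _ => (hH p).const_mul _),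
    integral_add hF'' hG'', integral_finsetSum _ fun p _ => hF' p,
    integral_finsetSum _ fun p _ => hG' p, integral_finsetSum _ fun p _ => (hH p).const_mul _]
  simp only [integral_finsetSum _ fun q _ => (hF _ q).const_mul _,
    integral_finsetSum _ fun q _ => (hG _ q).const_mul _, integral_const_mul]

/-- The right side is the shape produced by `signedIntegral_update_update`, so the two can be
compared term by term. -/
theorem integral_mul_clusterFunction (hφ : ∀ j, Integrable (φ j)) (hc : ∀ j, Continuous (φ j))
    (hf : Measurable f) (hfK : ∀ x, |f x| ≤ K) (hg : Measurable g) (hgK : ∀ x, |g x| ≤ K) :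
    ∫ z : ℝ × ℝ, f z.1 * g z.2 * clusterFunction φ z.1 z.2 =
      ∑ i, ∑ j, (skewCoord φ (fun x => f x * φ i x) j * skewCoord φ (fun x => g x * φ j x) i -
        (skewForm n (fun x => f x * φ i x) (fun x => g x * φ j x) -
          ∑ k, skewCoord φ (fun x => f x * φ i x) k *
            skewForm n (φ k) (fun x => g x * φ j x)) * (skewGram φ)⁻¹ j i) := by
  have h1 : ∀ i j k l : Fin n, Integrable fun z : ℝ × ℝ =>
      (f z.1 * φ i z.1 * (n * epsOp (φ k) z.1)) * (g z.2 * φ j z.2 * (n * epsOp (φ l) z.2)) :=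
    fun i j k l => (integrable_bdd_mul_epsOp hφ hc hf hfK i k).mul_prod
      (integrable_bdd_mul_epsOp hφ hc hg hgK j l)
  have h2 : ∀ i j : Fin n, Integrable fun z : ℝ × ℝ =>
      (f z.1 * φ i z.1) * (g z.2 * φ j z.2) * eps (z.1 - z.2) := fun i j =>
    integrable_mul_mul_eps (integrable_bdd_mul hφ hf hfK i) (integrable_bdd_mul hφ hg hgK j)
  have h3 : ∀ i j k l : Fin n, ∫ z : ℝ × ℝ,
      (f z.1 * φ i z.1 * (n * epsOp (φ k) z.1)) * (g z.2 * φ j z.2 * (n * epsOp (φ l) z.2)) =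
        skewForm n (fun x => f x * φ i x) (φ k) * skewForm n (fun x => g x * φ j x) (φ l) := by
    intro i j k l
    rw [Measure.volume_eq_prod, integral_prod_mul (fun x => f x * φ i x * (n * epsOp (φ k) x))
      fun y => g y * φ j y * (n * epsOp (φ l) y), integral_bdd_mul_epsOp, integral_bdd_mul_epsOp]
  have h4 : ∀ i j : Fin n, ∫ z : ℝ × ℝ,
      (n : ℝ) * ((f z.1 * φ i z.1) * (g z.2 * φ j z.2) * eps (z.1 - z.2)) =
        skewForm n (fun x => f x * φ i x) (fun x => g x * φ j x) := by
    intro i j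
    rw [integral_const_mul, ← skewForm_eq_integral_prod n (integrable_bdd_mul hφ hf hfK i)
      (integrable_bdd_mul hφ hg hgK j)]
  simp only [mul_clusterFunction]
  rw [integral_double_sums_add
    (fun p q : Fin n × Fin n => (skewGram φ)⁻¹ p.1 p.2 * (skewGram φ)⁻¹ q.1 q.2)
    (fun p q : Fin n × Fin n => (skewGram φ)⁻¹ p.1 p.2 * (skewGram φ)⁻¹ q.1 q.2)
    (fun p : Fin n × Fin n => (skewGram φ)⁻¹ p.1 p.2)
    (fun p q => h1 p.1 q.1 q.2 p.2) (fun p q => h1 p.1 p.2 q.1 q.2)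
    (fun p => (h2 p.1 p.2).const_mul n)]
  simp only [h3, h4]
  -- Skew symmetry reconciles the index orders: twice for `M⁻¹` here, once for `M⁻¹` and once for
  -- the form in `hB`, and only once in `hC`, which therefore acquires a sign.
  have hA : ∑ p : Fin n × Fin n, ∑ q : Fin n × Fin n,
      (skewGram φ)⁻¹ p.1 p.2 * (skewGram φ)⁻¹ q.1 q.2 *
        (skewForm n (fun x => f x * φ p.1 x) (φ q.2) *
          skewForm n (fun x => g x * φ q.1 x) (φ p.2)) =
      ∑ i, ∑ j, skewCoord φ (fun x => f x * φ i x) j * skewCoord φ (fun x => g x * φ j x) i := by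
    simp only [Fintype.sum_prod_type, skewCoord]
    refine Finset.sum_congr rfl fun i _ => ?_
    rw [Finset.sum_comm]
    refine Finset.sum_congr rfl fun j _ => ?_
    rw [Finset.sum_mul_sum, Finset.sum_comm]
    refine Finset.sum_congr rfl fun k _ => Finset.sum_congr rfl fun l _ => ?_
    rw [skewGram_inv_swap hφ i l, skewGram_inv_swap hφ j k]
    ring
  have hB : ∑ p : Fin n × Fin n, ∑ q : Fin n × Fin n,
      (skewGram φ)⁻¹ p.1 p.2 * (skewGram φ)⁻¹ q.1 q.2 *
        (skewForm n (fun x => f x * φ p.1 x) (φ q.1) *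
          skewForm n (fun x => g x * φ p.2 x) (φ q.2)) =
      ∑ i, ∑ j, (∑ k, skewCoord φ (fun x => f x * φ i x) k *
        skewForm n (φ k) (fun x => g x * φ j x)) * (skewGram φ)⁻¹ j i := by
    simp only [Fintype.sum_prod_type, skewCoord]
    refine Finset.sum_congr rfl fun i _ => Finset.sum_congr rfl fun j _ => ?_
    rw [Finset.sum_comm, Finset.sum_mul]
    refine Finset.sum_congr rfl fun l _ => ?_
    rw [Finset.sum_mul, Finset.sum_mul]
    refine Finset.sum_congr rfl fun k _ => ?_
    rw [skewForm_swap n (integrable_bdd_mul hφ hg hgK j) (hφ l), skewGram_inv_swap hφ i j]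
    ring
  have hC : ∑ p : Fin n × Fin n, (skewGram φ)⁻¹ p.1 p.2 *
      skewForm n (fun x => f x * φ p.1 x) (fun x => g x * φ p.2 x) =
      -∑ i, ∑ j, skewForm n (fun x => f x * φ i x) (fun x => g x * φ j x) *
        (skewGram φ)⁻¹ j i := by
    simp only [Fintype.sum_prod_type, ← Finset.sum_neg_distrib]
    refine Finset.sum_congr rfl fun i _ => Finset.sum_congr rfl fun j _ => ?_
    rw [skewGram_inv_swap hφ i j]
    ring
  rw [hA, hB, hC]
  simp only [Finset.sum_sub_distrib, sub_mul]
  ring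

end Cluster

/-! ### The eigenvalue law -/

section Law

variable {n : ℕ} {V : ℝ → ℝ}

/-- The functions `ψ_0, …, ψ_{n-1}`. -/
def psiFamily (n : ℕ) (V : ℝ → ℝ) (j : Fin n) : ℝ → ℝ := psi n V j

theorem signedIntegral_update_mul {φ : Fin n → ℝ → ℝ} (f : ℝ → ℝ) (i : Fin n) :
    signedIntegral (Function.update φ i fun x => f x * φ i x) =
      ∫ x : Fin n → ℝ, f (x i) * ((∏ j, φ j (x j)) * vandermondeSign x) := by
  unfold signedIntegral
  congr 1
  ext x
  rw [prod_update_apply, ← Finset.mul_prod_erase _ _ (Finset.mem_univ i)]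
  ring

theorem signedIntegral_update_update_mul {φ : Fin n → ℝ → ℝ} (f g : ℝ → ℝ) {i j : Fin n}
    (hij : i ≠ j) :
    signedIntegral (Function.update (Function.update φ j fun x => g x * φ j x) i
      fun x => f x * φ i x) =
      ∫ x : Fin n → ℝ, f (x i) * g (x j) * ((∏ j, φ j (x j)) * vandermondeSign x) := by
  unfold signedIntegral
  congr 1
  ext x
  have h1 : ∏ k ∈ Finset.univ.erase i, Function.update φ j (fun x => g x * φ j x) k (x k) =
      g (x j) * ∏ k ∈ Finset.univ.erase i, φ k (x k) := by
    have hj : j ∈ Finset.univ.erase i := Finset.mem_erase.2 ⟨hij.symm, Finset.mem_univ _⟩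
    rw [← Finset.mul_prod_erase _ _ hj, ← Finset.mul_prod_erase _ (fun k => φ k (x k)) hj,
      Function.update_self, mul_assoc]
    congr 2
    exact Finset.prod_congr rfl fun k hk => by
      rw [Function.update_of_ne (Finset.ne_of_mem_erase hk)]
  rw [prod_update_apply, h1, ← Finset.mul_prod_erase _ (fun k => φ k (x k)) (Finset.mem_univ i)]
  ring

/-- Taking `h = 1` in the symmetrized formula gives `Z = κ n! F` for the partition function `Z`.
Positivity of `Z` makes `F` nonzero, and the unknown constant `κ n!` drops out of all expectations.
-/
theorem integrable_and_signedIntegral_ne_zero (hn : 0 < n) (hV : Continuous V) {δ : ℝ}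
    (hδ : 0 < δ) (hg : ∀ x, 2 * (1 + δ) * Real.log (1 + |x|) ≤ V x) :
    0 < partitionFunction n V ∧ Integrable (jointWeight n V) ∧
      signedIntegral (psiFamily n V) ≠ 0 ∧
      ∀ h : (Fin n → ℝ) → ℝ, Measurable h → (∃ K, ∀ x, |h x| ≤ K) →
        (∀ (π : Equiv.Perm (Fin n)) x, h (x ∘ π) = h x) →
        (∫ x, h x * jointWeight n V x) * signedIntegral (psiFamily n V) =
          partitionFunction n V *
            ∫ x : Fin n → ℝ, h x * ((∏ j, psiFamily n V j (x j)) * vandermondeSign x) := by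
  obtain ⟨κ, hκ, hjw⟩ := exists_jointWeight_eq hn hV hδ hg
  have hψ : ∀ j, Integrable (psiFamily n V j) := fun j => integrable_psi hn hV hδ hg j.2
  have key : ∀ h : (Fin n → ℝ) → ℝ, Measurable h → (∃ K, ∀ x, |h x| ≤ K) →
      (∀ (π : Equiv.Perm (Fin n)) x, h (x ∘ π) = h x) →
      Integrable (fun x => h x * jointWeight n V x) ∧ ∫ x, h x * jointWeight n V x =
        κ * (n.factorial *
          ∫ x : Fin n → ℝ, h x * ((∏ j, psiFamily n V j (x j)) * vandermondeSign x)) := by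
    rintro h hm ⟨K, hK⟩ hsymm
    have heq : (fun x => h x * jointWeight n V x) = fun x => κ * (h x *
        ((Matrix.of fun i j : Fin n => psiFamily n V j (x i)).det * vandermondeSign x)) := by
      funext x
      rw [hjw]
      exact mul_left_comm _ _ _
    obtain ⟨hi, he⟩ := integral_mul_det_mul_sign hψ hm hK hsymm
    rw [heq, integral_const_mul, he]
    exact ⟨hi.const_mul κ, rfl⟩
  obtain ⟨hi, he⟩ := key (fun _ => 1) measurable_const ⟨1, fun _ => by simp⟩ fun _ _ => rfl
  simp only [one_mul] at hi he
  have hpos : 0 < partitionFunction n V := by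
    rw [partitionFunction, integral_pos_iff_support_of_nonneg jointWeight_nonneg hi]
    -- The point `(0, 1, …, n - 1)` has distinct coordinates, so the open support is nonempty.
    refine (continuous_jointWeight hV).isOpen_support.measure_pos _
      ⟨fun j => (j : ℝ), mul_ne_zero (Real.exp_pos _).ne' ?_⟩
    refine Finset.prod_ne_zero_iff.2 fun j _ => Finset.prod_ne_zero_iff.2 fun k hk => ?_
    rw [abs_ne_zero, sub_ne_zero]
    exact fun h => (Finset.mem_Ioi.1 hk).ne (Fin.ext (Nat.cast_injective (R := ℝ) h))
  have hZ : partitionFunction n V =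
      κ * (n.factorial * signedIntegral (psiFamily n V)) := he
  refine ⟨hpos, hi, ?_, ?_⟩
  · intro h0
    rw [hZ, h0, mul_zero, mul_zero] at hpos
    exact lt_irrefl _ hpos
  · intro h hm hK hsymm
    rw [(key h hm hK hsymm).2, hZ]
    ring

theorem isProbabilityMeasure_eigenvalueLaw (hZ : 0 < partitionFunction n V)
    (hi : Integrable (jointWeight n V)) : IsProbabilityMeasure (eigenvalueLaw n V) := by
  constructor
  have hnn : ∀ x, 0 ≤ jointDensity n V x := fun x =>
    mul_nonneg (inv_nonneg.2 hZ.le) (jointWeight_nonneg x)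
  rw [eigenvalueLaw, withDensity_apply _ MeasurableSet.univ, Measure.restrict_univ,
    ← ofReal_integral_eq_lintegral_ofReal (f := jointDensity n V) (hi.const_mul _)
      (Filter.Eventually.of_forall hnn)]
  simp only [jointDensity]
  rw [integral_const_mul, ← partitionFunction, inv_mul_cancel₀ hZ.ne', ENNReal.ofReal_one]

theorem integral_eigenvalueLaw (hV : Continuous V) (hZ : 0 < partitionFunction n V)
    (h : (Fin n → ℝ) → ℝ) :
    ∫ x, h x ∂(eigenvalueLaw n V) =
      (partitionFunction n V)⁻¹ * ∫ x, h x * jointWeight n V x := by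
  have hm : Measurable fun x => ENNReal.ofReal (jointDensity n V x) :=
    ((continuous_jointWeight hV).measurable.const_mul _).ennreal_ofReal
  rw [eigenvalueLaw, integral_withDensity_eq_integral_toReal_smul hm
    (Filter.Eventually.of_forall fun _ => ENNReal.ofReal_lt_top), ← integral_const_mul]
  congr 1
  ext x
  rw [jointDensity, smul_eq_mul,
    ENNReal.toReal_ofReal (mul_nonneg (inv_nonneg.2 hZ.le) (jointWeight_nonneg x))]
  ring

theorem signedIntegral_mul_integral_eigenvalueLaw (hn : 0 < n) (hV : Continuous V) {δ : ℝ}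
    (hδ : 0 < δ) (hg : ∀ x, 2 * (1 + δ) * Real.log (1 + |x|) ≤ V x) {h : (Fin n → ℝ) → ℝ}
    (hm : Measurable h) (hK : ∃ K, ∀ x, |h x| ≤ K)
    (hsymm : ∀ (π : Equiv.Perm (Fin n)) x, h (x ∘ π) = h x) :
    signedIntegral (psiFamily n V) * ∫ x, h x ∂(eigenvalueLaw n V) =
      ∫ x : Fin n → ℝ, h x * ((∏ j, psiFamily n V j (x j)) * vandermondeSign x) := by
  obtain ⟨hZ, -, -, hexp⟩ := integrable_and_signedIntegral_ne_zero hn hV hδ hg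
  rw [integral_eigenvalueLaw hV hZ, mul_left_comm, mul_comm (signedIntegral _),
    hexp h hm hK hsymm, inv_mul_cancel_left₀ hZ.ne']

end Law

/-! ### One- and two-point statistics of bounded functions -/

section Correlations

variable {n : ℕ} {φ : Fin n → ℝ → ℝ} {μ : Measure (Fin n → ℝ)} {f g : ℝ → ℝ} {K : ℝ}

theorem integral_sum_eq_sum_skewCoord (hn : Even n) (hφ : ∀ j, Integrable (φ j))
    (hF : signedIntegral φ ≠ 0)
    (hμ : ∀ h : (Fin n → ℝ) → ℝ, Measurable h → (∃ K, ∀ x, |h x| ≤ K) →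
      (∀ (π : Equiv.Perm (Fin n)) x, h (x ∘ π) = h x) →
      signedIntegral φ * ∫ x, h x ∂μ =
        ∫ x : Fin n → ℝ, h x * ((∏ j, φ j (x j)) * vandermondeSign x))
    (hf : Measurable f) (hK : ∀ x, |f x| ≤ K) :
    ∫ x, ∑ i, f (x i) ∂μ = ∑ i, skewCoord φ (fun x => f x * φ i x) i := by
  have h := hμ (fun x => ∑ i, f (x i))
    (Finset.measurable_fun_sum _ fun i _ => hf.comp (measurable_pi_apply i))
    ⟨∑ _i : Fin n, K, fun x => (Finset.abs_sum_le_sum_abs _ _).trans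
      (Finset.sum_le_sum fun i _ => hK _)⟩
    fun π x => Equiv.sum_comp π fun i => f (x i)
  refine mul_left_cancel₀ hF (h.trans ?_)
  simp only [Finset.sum_mul]
  rw [integral_finsetSum, Finset.mul_sum]
  · refine Finset.sum_congr rfl fun i _ => ?_
    rw [← signedIntegral_update_mul,
      (exists_row_expansion hn hφ hF).2.1 i _ (integrable_bdd_mul hφ hf hK i)]
  · exact fun i _ => (integrable_signed hφ).bdd_mul (c := K)
      (hf.comp (measurable_pi_apply i)).aestronglyMeasurable
      (Filter.Eventually.of_forall fun x => hK _)

/-- The summand for `i ≠ j` is the signed integral with `f φ_i` in slot `i` and `g φ_j` in slot `j`.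
The products of diagonal coordinates sum to the product of means; the rest is the integral of the
cluster function. -/
theorem integral_sum_sum_eq_sub (hn : Even n) (hφ : ∀ j, Integrable (φ j))
    (hc : ∀ j, Continuous (φ j)) (hF : signedIntegral φ ≠ 0)
    (hμ : ∀ h : (Fin n → ℝ) → ℝ, Measurable h → (∃ K, ∀ x, |h x| ≤ K) →
      (∀ (π : Equiv.Perm (Fin n)) x, h (x ∘ π) = h x) →
      signedIntegral φ * ∫ x, h x ∂μ =
        ∫ x : Fin n → ℝ, h x * ((∏ j, φ j (x j)) * vandermondeSign x))
    (hf : Measurable f) (hfK : ∀ x, |f x| ≤ K) (hg : Measurable g) (hgK : ∀ x, |g x| ≤ K) :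
    ∫ x, ∑ i, ∑ j, (if i = j then 0 else f (x i) * g (x j)) ∂μ =
      (∫ x, ∑ i, f (x i) ∂μ) * (∫ x, ∑ i, g (x i) ∂μ) -
        ∫ z : ℝ × ℝ, f z.1 * g z.2 * clusterFunction φ z.1 z.2 := by
  have hmeas : ∀ i j : Fin n,
      Measurable fun x : Fin n → ℝ => if i = j then 0 else f (x i) * g (x j) := by
    intro i j
    split_ifs
    · exact measurable_const
    · exact (hf.comp (measurable_pi_apply i)).mul (hg.comp (measurable_pi_apply j))
  have hbd : ∀ (i j : Fin n) (x : Fin n → ℝ), |if i = j then 0 else f (x i) * g (x j)| ≤ K * K := by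
    intro i j x
    have hK0 : 0 ≤ K := (abs_nonneg _).trans (hfK 0)
    split_ifs
    · rw [abs_zero]; positivity
    · rw [abs_mul]; exact mul_le_mul (hfK _) (hgK _) (abs_nonneg _) hK0
  have h := hμ (fun x => ∑ i, ∑ j, if i = j then 0 else f (x i) * g (x j))
    (Finset.measurable_fun_sum _ fun i _ => Finset.measurable_fun_sum _ fun j _ => hmeas i j)
    ⟨∑ _i : Fin n, ∑ _j : Fin n, K * K, fun x => (Finset.abs_sum_le_sum_abs _ _).trans
      (Finset.sum_le_sum fun i _ => (Finset.abs_sum_le_sum_abs _ _).trans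
        (Finset.sum_le_sum fun j _ => hbd i j x))⟩
    (fun π x => by
      have h1 : ∀ i j : Fin n, (if i = j then 0 else f ((x ∘ π) i) * g ((x ∘ π) j)) =
          (fun i j => if i = j then 0 else f (x i) * g (x j)) (π i) (π j) := by
        intro i j
        simp only [Function.comp_apply, EmbeddingLike.apply_eq_iff_eq]
      simp only [h1]
      rw [Equiv.sum_comp π fun i => ∑ j, (fun i j => if i = j then 0 else f (x i) * g (x j)) i (π j)]
      exact Finset.sum_congr rfl fun i _ =>
        Equiv.sum_comp π fun j => if i = j then 0 else f (x i) * g (x j))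
  have hint : ∀ i j : Fin n, Integrable fun x : Fin n → ℝ =>
      (if i = j then 0 else f (x i) * g (x j)) * ((∏ j, φ j (x j)) * vandermondeSign x) :=
    fun i j => (integrable_signed hφ).bdd_mul (c := K * K) (hmeas i j).aestronglyMeasurable
      (Filter.Eventually.of_forall (hbd i j))
  have hterm : ∀ i j : Fin n, ∫ x : Fin n → ℝ,
      (if i = j then 0 else f (x i) * g (x j)) * ((∏ j, φ j (x j)) * vandermondeSign x) =
      signedIntegral φ * (skewCoord φ (fun x => f x * φ i x) i * skewCoord φ (fun x => g x * φ j x) j -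
        (skewCoord φ (fun x => f x * φ i x) j * skewCoord φ (fun x => g x * φ j x) i -
          (skewForm n (fun x => f x * φ i x) (fun x => g x * φ j x) -
            ∑ k, skewCoord φ (fun x => f x * φ i x) k *
              skewForm n (φ k) (fun x => g x * φ j x)) * (skewGram φ)⁻¹ j i)) := by
    intro i j
    -- For `i = j` the formula also gives `0`, since the skew inverse has zero diagonal; so the sums
    -- may run over all pairs.
    rcases eq_or_ne i j with rfl | hij
    · have : (skewGram φ)⁻¹ i i = 0 := by linarith [skewGram_inv_swap hφ i i]
      simp [this]
    · simp only [if_neg hij]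
      rw [← signedIntegral_update_update_mul f g hij, signedIntegral_update_update hn hφ hF hij
        (integrable_bdd_mul hφ hf hfK i) (integrable_bdd_mul hφ hg hgK j)]
      ring
  refine mul_left_cancel₀ hF (h.trans ?_)
  simp only [Finset.sum_mul]
  rw [integral_finsetSum _ fun i _ => integrable_finsetSum _ fun j _ => hint i j]
  simp only [integral_finsetSum _ fun j _ => hint _ j, hterm]
  rw [integral_sum_eq_sum_skewCoord hn hφ hF hμ hf hfK,
    integral_sum_eq_sum_skewCoord hn hφ hF hμ hg hgK,
    integral_mul_clusterFunction hφ hc hf hfK hg hgK, Finset.sum_mul_sum]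
  simp only [← Finset.mul_sum, Finset.sum_sub_distrib]

end Correlations

/-! ### Measures with a signed density -/

/-- If `ν = ρ - T` as (finite) measures, a function integrable for `ν` and `ρ` is integrable
against the signed density `T`. -/
theorem integrable_mul_and_integral_of_add_withDensity {α : Type*} [MeasurableSpace α]
    {μ ν ρ : Measure α} {T : α → ℝ} (hT : Measurable T)
    (h : ν + μ.withDensity (fun x => ENNReal.ofReal (T x)) =
      ρ + μ.withDensity (fun x => ENNReal.ofReal (-T x)))
    {f : α → ℝ} (hν : Integrable f ν) (hρ : Integrable f ρ) :
    Integrable (fun x => f x * T x) μ ∧ ∫ x, f x * T x ∂μ = ∫ x, f x ∂ρ - ∫ x, f x ∂ν := by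
  set P := μ.withDensity (fun x => ENNReal.ofReal (T x)) with hP
  set N := μ.withDensity (fun x => ENNReal.ofReal (-T x)) with hN
  have hE : MeasurableSet {x | 0 < T x} := measurableSet_lt measurable_const hT
  have hP0 : P {x | 0 < T x}ᶜ = 0 := by
    rw [hP, withDensity_apply _ hE.compl, setLIntegral_eq_zero hE.compl]
    intro x hx
    exact ENNReal.ofReal_of_nonpos (not_lt.1 hx)
  have hN0 : N {x | 0 < T x} = 0 := by
    rw [hN, withDensity_apply _ hE, setLIntegral_eq_zero hE]
    intro x hx
    exact ENNReal.ofReal_of_nonpos (neg_nonpos.2 (le_of_lt hx))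
  -- On `{T > 0}` the measure `N` vanishes and the identity reads `ν + P = ρ`; off it `P` vanishes
  -- and it reads `ν = ρ + N`. This domination is what makes unbounded `f` integrable against `T`.
  have hPρ : P ≤ ρ := by
    refine Measure.le_iff.2 fun s hs => ?_
    have h1 := congrFun (congrArg (fun m : Measure α => (m : Set α → ENNReal)) h)
      (s ∩ {x | 0 < T x})
    simp only [Measure.add_apply] at h1
    rw [measure_mono_null Set.inter_subset_right hN0, add_zero] at h1
    calc P s = P (s ∩ {x | 0 < T x}) + P (s \ {x | 0 < T x}) := (measure_inter_add_sdiff s hE).symm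
      _ = P (s ∩ {x | 0 < T x}) := by
        rw [measure_mono_null (Set.sdiff_subset_compl s _) hP0, add_zero]
      _ ≤ ρ (s ∩ {x | 0 < T x}) := h1 ▸ le_add_self
      _ ≤ ρ s := measure_mono Set.inter_subset_left
  have hNν : N ≤ ν := by
    refine Measure.le_iff.2 fun s hs => ?_
    have h1 := congrFun (congrArg (fun m : Measure α => (m : Set α → ENNReal)) h)
      (s \ {x | 0 < T x})
    simp only [Measure.add_apply] at h1
    rw [measure_mono_null (Set.sdiff_subset_compl s _) hP0, add_zero] at h1
    calc N s = N (s ∩ {x | 0 < T x}) + N (s \ {x | 0 < T x}) := (measure_inter_add_sdiff s hE).symm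
      _ = N (s \ {x | 0 < T x}) := by
        rw [measure_mono_null Set.inter_subset_right hN0, zero_add]
      _ ≤ ν (s \ {x | 0 < T x}) := h1 ▸ le_add_self
      _ ≤ ν s := measure_mono Set.sdiff_subset
  have hfP : Integrable f P := hρ.mono_measure hPρ
  have hfN : Integrable f N := hν.mono_measure hNν
  have hTm : Measurable fun x => ENNReal.ofReal (T x) := hT.ennreal_ofReal
  have hTm' : Measurable fun x => ENNReal.ofReal (-T x) := hT.neg.ennreal_ofReal
  have hlt : ∀ g : α → ℝ, ∀ᵐ x ∂μ, ENNReal.ofReal (g x) < ⊤ :=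
    fun g => Filter.Eventually.of_forall fun _ => ENNReal.ofReal_lt_top
  have h1 := (integrable_withDensity_iff_integrable_smul' hTm (hlt _)).1 hfP
  have h2 := (integrable_withDensity_iff_integrable_smul' hTm' (hlt _)).1 hfN
  have heq : (fun x => f x * T x) = fun x => (ENNReal.ofReal (T x)).toReal • f x -
      (ENNReal.ofReal (-T x)).toReal • f x := by
    funext x
    rw [ENNReal.toReal_ofReal', ENNReal.toReal_ofReal', smul_eq_mul, smul_eq_mul, ← sub_mul,
      mul_comm]
    congr 1
    rcases le_total 0 (T x) with h | h
    · rw [max_eq_left h, max_eq_right (by linarith), sub_zero]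
    · rw [max_eq_right h, max_eq_left (by linarith)]; ring
  have htot : ∫ x, f x ∂ν + ∫ x, f x ∂P = ∫ x, f x ∂ρ + ∫ x, f x ∂N := by
    rw [← integral_add_measure hν hfP, ← integral_add_measure hρ hfN, h]
  rw [heq]
  refine ⟨h1.sub h2, ?_⟩
  rw [integral_sub h1 h2, ← integral_withDensity_eq_integral_toReal_smul hTm (hlt _),
    ← integral_withDensity_eq_integral_toReal_smul hTm' (hlt _)]
  linarith

/-! ### One- and two-point correlation measures -/

section Correlation

variable {n : ℕ}

/-- The one-point correlation measure. -/
def oneMeasure (μ : Measure (Fin n → ℝ)) : Measure ℝ := ∑ i, μ.map fun x => x i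

/-- The two-point correlation measure. -/
def twoMeasure (μ : Measure (Fin n → ℝ)) : Measure (ℝ × ℝ) :=
  ∑ p ∈ (Finset.univ : Finset (Fin n)).offDiag, μ.map fun x => (x p.1, x p.2)

variable {μ : Measure (Fin n → ℝ)}

theorem integrable_oneMeasure {f : ℝ → ℝ} (hf : Measurable f)
    (hi : ∀ i, Integrable (fun x => f (x i)) μ) :
    Integrable f (oneMeasure μ) ∧ ∫ y, f y ∂(oneMeasure μ) = ∑ i, ∫ x, f (x i) ∂μ := by
  have h1 : ∀ i ∈ (Finset.univ : Finset (Fin n)), Integrable f (μ.map fun x => x i) := fun i _ =>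
    (integrable_map_measure hf.aestronglyMeasurable (measurable_pi_apply i).aemeasurable).2 (hi i)
  refine ⟨integrable_finsetSum_measure.2 h1, ?_⟩
  rw [oneMeasure, integral_finsetSum_measure h1]
  exact Finset.sum_congr rfl fun i _ =>
    integral_map (measurable_pi_apply i).aemeasurable hf.aestronglyMeasurable

theorem integrable_twoMeasure {f : ℝ × ℝ → ℝ} (hf : Measurable f)
    (hi : ∀ i j, Integrable (fun x => f (x i, x j)) μ) :
    Integrable f (twoMeasure μ) ∧ ∫ y, f y ∂(twoMeasure μ) =
      ∑ p ∈ (Finset.univ : Finset (Fin n)).offDiag, ∫ x, f (x p.1, x p.2) ∂μ := by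
  have hm : ∀ p : Fin n × Fin n, Measurable fun x : Fin n → ℝ => (x p.1, x p.2) := fun p =>
    (measurable_pi_apply p.1).prodMk (measurable_pi_apply p.2)
  have h1 : ∀ p ∈ (Finset.univ : Finset (Fin n)).offDiag,
      Integrable f (μ.map fun x => (x p.1, x p.2)) := fun p _ =>
    (integrable_map_measure hf.aestronglyMeasurable (hm p).aemeasurable).2 (hi p.1 p.2)
  refine ⟨integrable_finsetSum_measure.2 h1, ?_⟩
  rw [twoMeasure, integral_finsetSum_measure h1]
  exact Finset.sum_congr rfl fun p _ =>
    integral_map (hm p).aemeasurable hf.aestronglyMeasurable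

theorem sum_offDiag (F : Fin n → Fin n → ℝ) :
    ∑ p ∈ (Finset.univ : Finset (Fin n)).offDiag, F p.1 p.2 =
      ∑ i, ∑ j, if i = j then 0 else F i j := by
  rw [← Fintype.sum_prod_type' fun i j => if i = j then 0 else F i j]
  have : (Finset.univ : Finset (Fin n)).offDiag =
      (Finset.univ : Finset (Fin n × Fin n)).filter fun p => ¬p.1 = p.2 := by
    ext p; simp
  rw [this, Finset.sum_filter]
  exact Finset.sum_congr rfl fun p _ => by by_cases h : p.1 = p.2 <;> simp [h]

instance [IsFiniteMeasure μ] : IsFiniteMeasure (oneMeasure μ) := by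
  unfold oneMeasure; infer_instance

instance [IsFiniteMeasure μ] : IsFiniteMeasure (twoMeasure μ) := by
  unfold twoMeasure; infer_instance

/-- The relation between correlation measures and a cluster function, from its integrated form. -/
theorem twoMeasure_add_withDensity [IsFiniteMeasure μ] {T : ℝ × ℝ → ℝ} (hT : Integrable T)
    (h : ∀ s t : Set ℝ, MeasurableSet s → MeasurableSet t →
      ∫ x, ∑ i, ∑ j, (if i = j then 0 else
          s.indicator (fun _ => (1 : ℝ)) (x i) * t.indicator (fun _ => (1 : ℝ)) (x j)) ∂μ =
        (∫ x, ∑ i, s.indicator (fun _ => (1 : ℝ)) (x i) ∂μ) *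
            (∫ x, ∑ i, t.indicator (fun _ => (1 : ℝ)) (x i) ∂μ) -
          ∫ z : ℝ × ℝ, s.indicator (fun _ => (1 : ℝ)) z.1 * t.indicator (fun _ => (1 : ℝ)) z.2 *
            T z) :
    twoMeasure μ + volume.withDensity (fun z => ENNReal.ofReal (T z)) =
      (oneMeasure μ).prod (oneMeasure μ) + volume.withDensity (fun z => ENNReal.ofReal (-T z)) := by
  have hfin : IsFiniteMeasure (volume.withDensity fun z => ENNReal.ofReal (T z)) :=
    isFiniteMeasure_withDensity_ofReal hT.2
  have hfin' : IsFiniteMeasure (volume.withDensity fun z => ENNReal.ofReal (-T z)) :=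
    isFiniteMeasure_withDensity_ofReal hT.neg.2
  have hind : ∀ s : Set ℝ, MeasurableSet s → Measurable (s.indicator fun _ => (1 : ℝ)) :=
    fun s hs => measurable_const.indicator hs
  have hbd : ∀ (s : Set ℝ) (y : ℝ), ‖s.indicator (fun _ => (1 : ℝ)) y‖ ≤ 1 := by
    intro s y
    by_cases hy : y ∈ s <;> simp [hy]
  have hint : ∀ s : Set ℝ, MeasurableSet s → ∀ i,
      Integrable (fun x : Fin n → ℝ => s.indicator (fun _ => (1 : ℝ)) (x i)) μ := fun s hs i =>
    Integrable.of_bound ((hind s hs).comp (measurable_pi_apply i)).aestronglyMeasurable 1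
      (Filter.Eventually.of_forall fun x => hbd s (x i))
  have hone : ∀ s : Set ℝ, MeasurableSet s →
      ∫ x, ∑ i, s.indicator (fun _ => (1 : ℝ)) (x i) ∂μ = (oneMeasure μ).real s := by
    intro s hs
    rw [integral_finsetSum _ fun i _ => hint s hs i,
      ← (integrable_oneMeasure (hind s hs) (hint s hs)).2]
    exact integral_indicator_one hs
  -- Finite measures on the plane are determined by measurable rectangles, which is the case of
  -- indicators `f` and `g`.
  refine Measure.ext_prod fun {s t} hs ht => ?_
  have hst := hs.prod ht
  have hprod : ∀ z : ℝ × ℝ, (s ×ˢ t).indicator (fun _ => (1 : ℝ)) z =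
      s.indicator (fun _ => (1 : ℝ)) z.1 * t.indicator (fun _ => (1 : ℝ)) z.2 := by
    intro z
    by_cases h1 : z.1 ∈ s <;> by_cases h2 : z.2 ∈ t <;> simp [Set.indicator, Set.mem_prod, h1, h2]
  have hint2 : ∀ i j, Integrable (fun x : Fin n → ℝ =>
      (s ×ˢ t).indicator (fun _ => (1 : ℝ)) (x i, x j)) μ := by
    intro i j
    simp only [hprod]
    exact (hint s hs i).mul_bdd (c := 1)
      ((hind t ht).comp (measurable_pi_apply j)).aestronglyMeasurable
      (Filter.Eventually.of_forall fun x => hbd t (x j))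
  have htwo : ∫ x, ∑ i, ∑ j, (if i = j then 0 else
      s.indicator (fun _ => (1 : ℝ)) (x i) * t.indicator (fun _ => (1 : ℝ)) (x j)) ∂μ =
        (twoMeasure μ).real (s ×ˢ t) := by
    have h1 := (integrable_twoMeasure (measurable_const.indicator hst) hint2).2
    rw [← integral_finsetSum _ fun p _ => hint2 p.1 p.2] at h1
    rw [← integral_indicator_one hst]
    refine Eq.trans ?_ h1.symm
    congr 1
    ext x
    simp only [hprod]
    exact (sum_offDiag fun i j => s.indicator (fun _ => (1 : ℝ)) (x i) *
      t.indicator (fun _ => (1 : ℝ)) (x j)).symm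
  have hTint : ∫ z : ℝ × ℝ, s.indicator (fun _ => (1 : ℝ)) z.1 *
      t.indicator (fun _ => (1 : ℝ)) z.2 * T z =
        (volume.withDensity fun z => ENNReal.ofReal (T z)).real (s ×ˢ t) -
          (volume.withDensity fun z => ENNReal.ofReal (-T z)).real (s ×ˢ t) := by
    rw [measureReal_def, measureReal_def, withDensity_apply _ hst, withDensity_apply _ hst,
      ← integral_eq_lintegral_pos_part_sub_lintegral_neg_part hT.integrableOn,
      ← integral_indicator hst]
    congr 1
    ext z
    rw [← hprod]
    by_cases hz : z ∈ s ×ˢ t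
    · rw [Set.indicator_of_mem hz, Set.indicator_of_mem hz, one_mul]
    · rw [Set.indicator_of_notMem hz, Set.indicator_of_notMem hz, zero_mul]
  have hreal := h s t hs ht
  rw [htwo, hone s hs, hone t ht, hTint] at hreal
  rw [← ENNReal.toReal_eq_toReal_iff' (measure_ne_top _ _) (measure_ne_top _ _),
    Measure.add_apply, Measure.add_apply, Measure.prod_prod,
    ENNReal.toReal_add (measure_ne_top _ _) (measure_ne_top _ _),
    ENNReal.toReal_add (ENNReal.mul_ne_top (measure_ne_top _ _) (measure_ne_top _ _))
      (measure_ne_top _ _), ENNReal.toReal_mul]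
  simp only [measureReal_def] at hreal
  linarith

/-- The variance of a linear statistic, in terms of a cluster function. -/
theorem variance_linearStatistic_eq [IsProbabilityMeasure μ] {T : ℝ × ℝ → ℝ} (hT : Measurable T)
    (h : twoMeasure μ + volume.withDensity (fun z => ENNReal.ofReal (T z)) =
      (oneMeasure μ).prod (oneMeasure μ) + volume.withDensity (fun z => ENNReal.ofReal (-T z)))
    {φ : ℝ → ℝ} (hφ : Measurable φ) (hsq : ∀ j, MemLp (fun x : Fin n → ℝ => φ (x j)) 2 μ) :
    Integrable (fun z : ℝ × ℝ => (φ z.1 - φ z.2) ^ 2 * T z) ∧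
      ∫ z : ℝ × ℝ, (φ z.1 - φ z.2) ^ 2 * T z = 2 * variance (linearStatistic n φ) μ := by
  have hi1 : ∀ i, Integrable (fun x : Fin n → ℝ => φ (x i)) μ :=
    fun i => (hsq i).integrable one_le_two
  have hi2 : ∀ i, Integrable (fun x : Fin n → ℝ => φ (x i) ^ 2) μ := fun i => (hsq i).integrable_sq
  obtain ⟨h1i, h1⟩ := integrable_oneMeasure hφ hi1
  obtain ⟨h2i, h2⟩ := integrable_oneMeasure (hφ.pow_const 2) hi2
  have hd : ∀ i j, Integrable (fun x : Fin n → ℝ => (φ (x i) - φ (x j)) ^ 2) μ := fun i j =>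
    ((hsq i).sub (hsq j)).integrable_sq
  have hm : Measurable fun z : ℝ × ℝ => (φ z.1 - φ z.2) ^ 2 :=
    ((hφ.comp measurable_fst).sub (hφ.comp measurable_snd)).pow_const 2
  obtain ⟨htwoi, htwo⟩ := integrable_twoMeasure hm hd
  have hmass : (oneMeasure μ).real Set.univ = n := by
    have := (integrable_oneMeasure (μ := μ) (f := fun _ => (1 : ℝ)) measurable_const
      fun _ => integrable_const _).2
    simpa using this
  have hexp : (fun z : ℝ × ℝ => (φ z.1 - φ z.2) ^ 2) =
      fun z => φ z.1 ^ 2 * 1 + 1 * φ z.2 ^ 2 - 2 * (φ z.1 * φ z.2) := by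
    funext z; ring
  have hp1 : Integrable (fun z : ℝ × ℝ => φ z.1 ^ 2 * 1) ((oneMeasure μ).prod (oneMeasure μ)) :=
    h2i.mul_prod (integrable_const 1)
  have hp2 : Integrable (fun z : ℝ × ℝ => 1 * φ z.2 ^ 2) ((oneMeasure μ).prod (oneMeasure μ)) :=
    (integrable_const 1).mul_prod h2i
  have hp3 : Integrable (fun z : ℝ × ℝ => 2 * (φ z.1 * φ z.2))
      ((oneMeasure μ).prod (oneMeasure μ)) := (h1i.mul_prod h1i).const_mul 2
  have hp12 : Integrable (fun z : ℝ × ℝ => φ z.1 ^ 2 * 1 + 1 * φ z.2 ^ 2)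
      ((oneMeasure μ).prod (oneMeasure μ)) := hp1.add hp2
  have hρi : Integrable (fun z : ℝ × ℝ => (φ z.1 - φ z.2) ^ 2)
      ((oneMeasure μ).prod (oneMeasure μ)) := by
    rw [hexp]
    exact hp12.sub hp3
  have hρ : ∫ z : ℝ × ℝ, (φ z.1 - φ z.2) ^ 2 ∂((oneMeasure μ).prod (oneMeasure μ)) =
      2 * n * (∑ i, ∫ x, φ (x i) ^ 2 ∂μ) - 2 * (∑ i, ∫ x, φ (x i) ∂μ) ^ 2 := by
    rw [hexp, integral_sub hp12 hp3, integral_add hp1 hp2,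
      integral_prod_mul (fun y => φ y ^ 2) fun _ => (1 : ℝ),
      integral_prod_mul (fun _ => (1 : ℝ)) fun y => φ y ^ 2,
      integral_const_mul, integral_prod_mul φ φ, h1, h2,
      integral_const, hmass, smul_eq_mul]
    ring
  obtain ⟨hfin, heq⟩ := integrable_mul_and_integral_of_add_withDensity hT h htwoi hρi
  refine ⟨hfin, ?_⟩
  have hN : MemLp (linearStatistic n φ) 2 μ := memLp_finsetSum _ fun j _ => hsq j
  have hNmean : ∫ x, linearStatistic n φ x ∂μ = ∑ i, ∫ x, φ (x i) ∂μ :=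
    integral_finsetSum _ fun i _ => hi1 i
  -- The diagonal terms vanish, so the square can be expanded over all pairs. The term `2n ∑ E
  -- φ(λ_i)²` is the one found in `hρ` and cancels, leaving `2 (E N² - (E N)²)`.
  have hpair : ∑ p ∈ (Finset.univ : Finset (Fin n)).offDiag,
      ∫ x, (φ (x p.1) - φ (x p.2)) ^ 2 ∂μ =
        2 * n * (∑ i, ∫ x, φ (x i) ^ 2 ∂μ) - 2 * ∫ x, linearStatistic n φ x ^ 2 ∂μ := by
    rw [← integral_finsetSum _ fun p _ => hd p.1 p.2, ← integral_finsetSum _ fun i _ => hi2 i,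
      ← integral_const_mul, ← integral_const_mul,
      ← integral_sub ((integrable_finsetSum _ fun i _ => hi2 i).const_mul _)
        (hN.integrable_sq.const_mul _)]
    congr 1
    ext x
    rw [sum_offDiag fun i j => (φ (x i) - φ (x j)) ^ 2]
    have h0 : ∀ i j : Fin n, (if i = j then 0 else (φ (x i) - φ (x j)) ^ 2) =
        φ (x i) ^ 2 + φ (x j) ^ 2 - 2 * (φ (x i) * φ (x j)) := by
      intro i j
      split_ifs with hij
      · rw [hij]; ring
      · ring
    simp only [h0, linearStatistic, Finset.sum_sub_distrib, Finset.sum_add_distrib,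
      Finset.sum_const, Finset.card_univ, Fintype.card_fin, nsmul_eq_mul, ← Finset.mul_sum,
      sq (∑ j, φ (x j)), Finset.sum_mul_sum]
    ring
  rw [heq, hρ, htwo, hpair, variance_eq_sub hN, hNmean]
  simp only [Pi.pow_apply]
  ring

end Correlation

/-! ### The Tracy–Widom kernel -/

section Kernel

variable {n : ℕ} {V : ℝ → ℝ}

theorem skewMatrix_eq_skewGram (n : ℕ) (V : ℝ → ℝ) :
    skewMatrix n V = skewGram (psiFamily n V) := rfl

theorem kernelS_eq_neg_scalarKernel (n : ℕ) (V : ℝ → ℝ) (x y : ℝ) :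
    kernelS n V x y = -scalarKernel (psiFamily n V) x y := by
  rw [kernelS, scalarKernel, Fintype.sum_prod_type, skewMatrix_eq_skewGram]
  rfl

theorem hasDerivAt_kernelS (hi : ∀ j, Integrable (psiFamily n V j))
    (hc : ∀ j, Continuous (psiFamily n V j)) (x y : ℝ) :
    HasDerivAt (kernelS n V x) (-derivKernel (psiFamily n V) x y) y := by
  have : kernelS n V x = fun z => -scalarKernel (psiFamily n V) x z :=
    funext (kernelS_eq_neg_scalarKernel n V x)
  rw [this]
  have h : ∀ p : Fin n × Fin n, HasDerivAt
      (fun z => psiFamily n V p.1 x * (skewGram (psiFamily n V))⁻¹ p.1 p.2 *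
        (n * epsOp (psiFamily n V p.2) z))
      (psiFamily n V p.1 x * (skewGram (psiFamily n V))⁻¹ p.1 p.2 * (n * psiFamily n V p.2 y)) y :=
    fun p => ((hasDerivAt_epsOp (hi p.2) (hc p.2) y).const_mul _).const_mul _
  exact (HasDerivAt.fun_sum (u := Finset.univ) fun p _ => h p).neg

theorem kernelSd_eq_derivKernel (hi : ∀ j, Integrable (psiFamily n V j))
    (hc : ∀ j, Continuous (psiFamily n V j)) (x y : ℝ) :
    kernelSd n V x y = derivKernel (psiFamily n V) x y := by
  rw [kernelSd, (hasDerivAt_kernelS hi hc x y).deriv, neg_neg]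

theorem integrable_kernelS (hi : ∀ j, Integrable (psiFamily n V j)) (y : ℝ) :
    Integrable fun x => kernelS n V x y := by
  simp only [kernelS_eq_neg_scalarKernel]
  exact (integrable_finsetSum _ fun p _ => ((hi p.1).mul_const _).mul_const _).neg

theorem kernelIS_eq_neg_integralKernel (hi : ∀ j, Integrable (psiFamily n V j)) (x y : ℝ) :
    kernelIS n V x y = -integralKernel (psiFamily n V) x y := by
  have h : ∀ z, eps (x - z) * kernelS n V z y = -∑ p : Fin n × Fin n,
      eps (x - z) * psiFamily n V p.1 z * ((skewGram (psiFamily n V))⁻¹ p.1 p.2 *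
        (n * epsOp (psiFamily n V p.2) y)) := by
    intro z
    rw [kernelS_eq_neg_scalarKernel, scalarKernel, mul_neg, Finset.mul_sum]
    exact congrArg _ (Finset.sum_congr rfl fun p _ => by ring)
  rw [kernelIS, epsOp]
  simp only [h]
  rw [integral_neg, integral_finsetSum _ fun p _ => (integrable_eps_mul (hi p.1) x).mul_const _,
    integralKernel]
  refine congrArg _ (Finset.sum_congr rfl fun p _ => ?_)
  rw [integral_mul_const, mul_assoc]
  rfl

theorem derivKernel_swap {φ : Fin n → ℝ → ℝ} (hφ : ∀ j, Integrable (φ j)) (x y : ℝ) :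
    derivKernel φ y x = -derivKernel φ x y := by
  rw [derivKernel, derivKernel, ← Equiv.sum_comp (Equiv.prodComm (Fin n) (Fin n)),
    ← Finset.sum_neg_distrib]
  refine Finset.sum_congr rfl fun p _ => ?_
  simp only [Equiv.prodComm_apply, Prod.fst_swap, Prod.snd_swap]
  rw [skewGram_inv_swap hφ p.1 p.2]
  ring

theorem integralKernel_swap {φ : Fin n → ℝ → ℝ} (hφ : ∀ j, Integrable (φ j)) (x y : ℝ) :
    integralKernel φ y x = -integralKernel φ x y := by
  rw [integralKernel, integralKernel, ← Equiv.sum_comp (Equiv.prodComm (Fin n) (Fin n)),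
    ← Finset.sum_neg_distrib]
  refine Finset.sum_congr rfl fun p _ => ?_
  simp only [Equiv.prodComm_apply, Prod.fst_swap, Prod.snd_swap]
  rw [skewGram_inv_swap hφ p.1 p.2]
  ring

/-- The derivative kernel, the integrated kernel and `eps` are all antisymmetric, so the two
off-diagonal contributions to the trace coincide, as do the two diagonal ones. -/
theorem trace_matrixKernel_mul (hi : ∀ j, Integrable (psiFamily n V j))
    (hc : ∀ j, Continuous (psiFamily n V j)) (x y : ℝ) :
    (matrixKernel n V x y * matrixKernel n V y x).trace =
      2 * clusterFunction (psiFamily n V) x y := by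
  rw [Matrix.trace_fin_two, Matrix.mul_apply, Matrix.mul_apply, Fin.sum_univ_two,
    Fin.sum_univ_two]
  simp only [matrixKernel, Matrix.of_apply, Matrix.cons_val', Matrix.cons_val_zero,
    Matrix.cons_val_one, Matrix.cons_val_fin_one, kernelS_eq_neg_scalarKernel,
    kernelSd_eq_derivKernel hi hc, kernelIS_eq_neg_integralKernel hi]
  rw [derivKernel_swap hi x y, integralKernel_swap hi x y, clusterFunction, ← neg_sub x y, eps_neg]
  ring

theorem measurable_clusterFunction {φ : Fin n → ℝ → ℝ} (hφ : ∀ j, Integrable (φ j))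
    (hc : ∀ j, Continuous (φ j)) :
    Measurable fun z : ℝ × ℝ => clusterFunction φ z.1 z.2 := by
  have h1 : ∀ j, Measurable (φ j) := fun j => (hc j).measurable
  have h2 : ∀ j, Measurable (epsOp (φ j)) := fun j => (continuous_epsOp (hφ j) (hc j)).measurable
  have h3 := measurable_eps
  unfold clusterFunction scalarKernel derivKernel integralKernel
  fun_prop

end Kernel

end OrthogonalEnsemble

end

/-! ### The variance formula -/

theorem proposition1 (n : ℕ) (hn : 0 < n) (hn_even : Even n)
    (V : ℝ → ℝ) (hV_nonneg : ∀ x, 0 ≤ V x) (hV_cont : Continuous V)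
    (δ : ℝ) (hδ : 0 < δ) (hV_growth : ∀ x, 2 * (1 + δ) * Real.log (1 + |x|) ≤ |V x|)
    (φ : ℝ → ℝ) (hφ : Measurable φ)
    (hφ_sq : ∀ j : Fin n, MemLp (fun x : Fin n → ℝ => φ (x j)) 2
      (OrthogonalEnsemble.eigenvalueLaw n V)) :
    -- the objects in the formula are well defined
    IsProbabilityMeasure (OrthogonalEnsemble.eigenvalueLaw n V) ∧
    IsUnit (OrthogonalEnsemble.skewMatrix n V).det ∧
    (∀ x, Differentiable ℝ (OrthogonalEnsemble.kernelS n V x)) ∧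
    (∀ y, Integrable fun x => OrthogonalEnsemble.kernelS n V x y) ∧
    Integrable (fun z : ℝ × ℝ => (φ z.1 - φ z.2) ^ 2 *
      (OrthogonalEnsemble.matrixKernel n V z.1 z.2 *
        OrthogonalEnsemble.matrixKernel n V z.2 z.1).trace) ∧
    -- the formula
    variance (OrthogonalEnsemble.linearStatistic n φ) (OrthogonalEnsemble.eigenvalueLaw n V) =
      1 / 4 * ∫ μ₁ : ℝ, ∫ μ₂ : ℝ, (φ μ₁ - φ μ₂) ^ 2 *
        (OrthogonalEnsemble.matrixKernel n V μ₁ μ₂ *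
          OrthogonalEnsemble.matrixKernel n V μ₂ μ₁).trace := by
  have hg : ∀ x, 2 * (1 + δ) * Real.log (1 + |x|) ≤ V x := fun x => by
    rw [← abs_of_nonneg (hV_nonneg x)]; exact hV_growth x
  have hi : ∀ j, Integrable (OrthogonalEnsemble.psiFamily n V j) :=
    fun j => OrthogonalEnsemble.integrable_psi hn hV_cont hδ hg j.2
  have hc : ∀ j, Continuous (OrthogonalEnsemble.psiFamily n V j) :=
    fun j => OrthogonalEnsemble.continuous_psi hV_cont j
  obtain ⟨hZ, hjw, hF, -⟩ :=
    OrthogonalEnsemble.integrable_and_signedIntegral_ne_zero hn hV_cont hδ hg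
  have hprob := OrthogonalEnsemble.isProbabilityMeasure_eigenvalueLaw hZ hjw
  have hbd : ∀ (s : Set ℝ) (y : ℝ), |s.indicator (fun _ => (1 : ℝ)) y| ≤ 1 := by
    intro s y
    by_cases hy : y ∈ s <;> simp [hy]
  have hT : Integrable fun z : ℝ × ℝ =>
      OrthogonalEnsemble.clusterFunction (OrthogonalEnsemble.psiFamily n V) z.1 z.2 := by
    -- The test functions `f = g = 1` give integrability of the cluster function itself.
    have := OrthogonalEnsemble.integrable_mul_clusterFunction (K := 1) hi hc
      (f := fun _ => 1) (g := fun _ => 1) measurable_const (fun _ => by simp) measurable_const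
      (fun _ => by simp)
    simpa using this
  have hmeas := OrthogonalEnsemble.twoMeasure_add_withDensity hT fun s t hs ht =>
    OrthogonalEnsemble.integral_sum_sum_eq_sub hn_even hi hc hF
      (fun h hm hK hsymm => OrthogonalEnsemble.signedIntegral_mul_integral_eigenvalueLaw hn hV_cont
        hδ hg hm hK hsymm)
      (measurable_const.indicator hs) (hbd s) (measurable_const.indicator ht) (hbd t)
  obtain ⟨hint, hvar⟩ := OrthogonalEnsemble.variance_linearStatistic_eq
    (OrthogonalEnsemble.measurable_clusterFunction hi hc) hmeas hφ hφ_sq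
  have htr : ∀ z : ℝ × ℝ, (φ z.1 - φ z.2) ^ 2 * (OrthogonalEnsemble.matrixKernel n V z.1 z.2 *
      OrthogonalEnsemble.matrixKernel n V z.2 z.1).trace = 2 * ((φ z.1 - φ z.2) ^ 2 *
        OrthogonalEnsemble.clusterFunction (OrthogonalEnsemble.psiFamily n V) z.1 z.2) := by
    intro z
    rw [OrthogonalEnsemble.trace_matrixKernel_mul hi hc]
    ring
  have hfin : Integrable fun z : ℝ × ℝ => (φ z.1 - φ z.2) ^ 2 *
      (OrthogonalEnsemble.matrixKernel n V z.1 z.2 *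
        OrthogonalEnsemble.matrixKernel n V z.2 z.1).trace := by
    simp only [htr]
    exact hint.const_mul 2
  refine ⟨hprob, ?_, fun x y => (OrthogonalEnsemble.hasDerivAt_kernelS hi hc x y).differentiableAt,
    OrthogonalEnsemble.integrable_kernelS hi, hfin, ?_⟩
  · rw [OrthogonalEnsemble.skewMatrix_eq_skewGram]
    exact (OrthogonalEnsemble.exists_row_expansion hn_even hi hF).1
  -- The constant `1 / 4` offsets two factors of `2`: the trace is twice the cluster function, whose
  -- weighted integral is twice the variance.
  · rw [← integral_prod _ hfin, ← Measure.volume_eq_prod]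
    simp only [htr]
    rw [integral_const_mul, hvar]
    ring
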